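/- **Definitions.** Let $Q$ be a convex polytope of dimension $d$ and let $f_i(Q)$ be the number of its $i$-dimensional faces. Put $F(Q)(\alpha,t)=\sum_{i=0}^{d} f_i(Q)\,\alpha^{i}t^{d-i}$ and $H(Q)(\alpha,t)=F(Q)(\alpha-t,t)$. A polynomial $\gamma(Q)(\tau)=\sum_{i=0}^{\lfloor d/2\rfloor}\gamma_i\tau^i$ is the $\gamma$-polynomial of $Q$ if $H(Q)(\alpha,t)=\sum_{i=0}^{\lfloor d/2\rfloor}\gamma_i(\alpha t)^i(\alpha+t)^{d-2i}$ (such a polynomial is unique, and it exists if $Q$ is simple). For a finite simplicial complex $K$ with $f_i$ simplices of dimension $i$, the $f$-polynomial is $f(K)(\tau)=1+f_0\tau+f_1\tau^2+\cdots$; the complex $K$ is flag if every clique of its $1$-skeleton is a simplex. For a simple $n$-dimensional polytope $P$, let $\partial P^*$ be the simplicial complex whose simplices $\sigma_Q$ (including the empty one, $\sigma_P=\varnothing$) correspond to the nonempty faces $Q$ of $P$ with inclusions reversed. A simple $n$-polytope $\tilde P$ is obtained from $P$ by $2$-truncation of a face $G$ of codimension $2$ if $\partial\tilde P^*$ is the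 stellar subdivision of $\partial P^*$ along $\sigma_G$; the new vertex $v$ corresponds to the section facet of $\tilde P$. A $2$-truncated cube is a polytope obtained from a polytope combinatorially equivalent to $[0,1]^n$ by a finite sequence of $2$-truncations. **Construction.** Let $P$ be obtained from a cube by a sequence of $m$ $2$-truncations. Define simplicial complexes $\Delta(Q)$ for all nonempty faces $Q$ of $P$ (including $Q=P$), with vertices in $\{w_1,\dots,w_m\}$, as follows. If $m=0$, every $\Delta(Q)$ is the complex without vertices. If $\tilde P$ is obtained from $P$ by the $m$-th $2$-truncation, of the face $G$, and $\tilde Q$ is a face of $\tilde P$, let $Q$ be the face of $P$ with $\sigma_Q=\sigma_{\tilde Q}$ if $v\notin\sigma_{\tilde Q}$, and with $\sigma_Q=(\sigma_{\tilde Q}\setminus\{v\})\cup\sigma_G$ if $v\in\sigma_{\tilde Q}$. Then $$\Delta(\tilde Q)=\begin{cases}\Delta(Q)\cup\bigl(\Delta(G\cap Q)\star w_m\bigr)&\text{if } G\cap Q\text{ is a nonempty face of codimension } 2 \text{ of } Q,\\ \Delta(Q)&\text{otherwise.}\end{cases}$$ **Theorem.** For every $2$-truncated cube $P$ there is a finite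 flag simplicial complex $\Delta$ with $f(\Delta)=\gamma(P)$. More precisely, for every sequence of $m$ $2$-truncations leading from a cube to $P$ and for every nonempty face $Q$ of $P$ (including $Q=P$), the complex $\Delta(Q)$ of the construction has all its vertices in $\{w_1,\dots,w_m\}$, is flag, and satisfies $f(\Delta(Q))=\gamma(Q)$. -/

import Mathlib

noncomputable section

namespace TwoTruncatedCube

variable {E : Type*} [NormedAddCommGroup E] [NormedSpace ℝ E]

/-! ### Convex polytopes, faces, and the polynomials `F`, `H`, `γ` -/

/-- The dimension of a convex set: the dimension of its affine hull. -/
def dim (A : Set E) : ℕ := Module.finrank ℝ (vectorSpan ℝ A)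

/-- A convex polytope of dimension `n` in the real vector space `E`. -/
structure ConvexPolytope (E : Type*) [NormedAddCommGroup E] [NormedSpace ℝ E] (n : ℕ) where
  carrier : Set E
  isHull : ∃ S : Finset E, S.Nonempty ∧ carrier = convexHull ℝ (S : Set E)
  dim_eq : dim carrier = n

/-- The nonempty faces of `A` (the sets where some linear functional attains its maximum on `A`;
the zero functional gives `A` itself), ordered by inclusion. -/
abbrev Face (A : Set E) : Type _ := {B : Set E // B.Nonempty ∧ IsExposed ℝ A B}

/-- The intersection of two faces that meet is a face. -/
def Face.inter {A : Set E} (B C : Face A) (h : (B.1 ∩ C.1).Nonempty) : Face A :=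
  ⟨B.1 ∩ C.1, h, B.2.2.inter C.2.2⟩

/-- The number of `i`-dimensional faces. -/
def faceNumber (A : Set E) (i : ℕ) : ℕ := Nat.card {B : Face A // dim B.1 = i}

/-- `F(α, t) = ∑ f_i α ^ i t ^ (d - i)`, where `d` is the dimension; `α` is the variable `X 0` and
`t` is the variable `X 1`. -/
def FPolynomial (A : Set E) : MvPolynomial (Fin 2) ℤ :=
  ∑ i ∈ Finset.range (dim A + 1),
    MvPolynomial.C (faceNumber A i : ℤ) * MvPolynomial.X 0 ^ i * MvPolynomial.X 1 ^ (dim A - i)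

/-- `H(α, t) = F(α - t, t)`. -/
def HPolynomial (A : Set E) : MvPolynomial (Fin 2) ℤ :=
  MvPolynomial.bind₁ ![MvPolynomial.X 0 - MvPolynomial.X 1, MvPolynomial.X 1] (FPolynomial A)

/-- `g` is the `γ`-polynomial of `A`: its degree is at most `⌊d / 2⌋` and
`H(α, t) = ∑ γ_i (α t) ^ i (α + t) ^ (d - 2 i)`, where `γ_i` is the coefficient of `g` at `i`. -/
def IsGammaPolynomial (A : Set E) (g : Polynomial ℤ) : Prop :=
  g.natDegree ≤ dim A / 2 ∧
  HPolynomial A = ∑ i ∈ Finset.range (dim A / 2 + 1),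
    MvPolynomial.C (g.coeff i) * (MvPolynomial.X 0 * MvPolynomial.X 1) ^ i *
      (MvPolynomial.X 0 + MvPolynomial.X 1) ^ (dim A - 2 * i)

/-! ### Abstract simplicial complexes

The faces of a `PreAbstractSimplicialComplex` are its nonempty simplices. -/

/-- The simplices of a complex, the empty one included, ordered by inclusion. -/
abbrev Simplex {V : Type*} (K : PreAbstractSimplicialComplex V) : Type _ :=
  {s : Finset V // s = ∅ ∨ s ∈ K.faces}

/-- Every clique of the 1-skeleton forms a simplex. -/
def IsFlag {V : Type*} [DecidableEq V] (K : PreAbstractSimplicialComplex V) : Prop :=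
  ∀ s : Finset V, s.Nonempty → (∀ v ∈ s, {v} ∈ K.faces) →
    (∀ u ∈ s, ∀ v ∈ s, u ≠ v → {u, v} ∈ K.faces) → s ∈ K.faces

/-- `f(K) = 1 + f_0 t + f_1 t ^ 2 + ...` for a finite complex `K`. -/
def fPolynomial {V : Type*} (K : PreAbstractSimplicialComplex V) : Polynomial ℤ :=
  1 + ∑ᶠ s ∈ K.faces, Polynomial.X ^ s.card

/-- The cone `K ⋆ w`. -/
def cone {V : Type*} [DecidableEq V] (K : PreAbstractSimplicialComplex V) (w : V) :
    PreAbstractSimplicialComplex V where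
  faces := K.faces ∪ {s | w ∈ s ∧ (s.erase w = ∅ ∨ s.erase w ∈ K.faces)}
  isRelLowerSet_faces := by
    rintro s (hs | ⟨hw, hs⟩)
    · exact ⟨(K.isRelLowerSet_faces hs).1,
        fun t ht hne => Or.inl ((K.isRelLowerSet_faces hs).2 ht hne)⟩
    · refine ⟨⟨w, hw⟩, fun t ht hne => ?_⟩
      have hsub : t.erase w ⊆ s.erase w := Finset.erase_subset_erase w ht
      have key : t.erase w = ∅ ∨ t.erase w ∈ K.faces := by
        rcases Finset.eq_empty_or_nonempty (t.erase w) with h | h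
        · exact Or.inl h
        · rcases hs with hs | hs
          · rw [hs] at hsub
            exact Or.inl (Finset.subset_empty.mp hsub)
          · exact Or.inr ((K.isRelLowerSet_faces hs).2 hsub h)
      by_cases hwt : w ∈ t
      · exact Or.inr ⟨hwt, key⟩
      · rw [Finset.erase_eq_of_notMem hwt] at key
        exact Or.inl (key.resolve_left hne.ne_empty)

/-- The stellar subdivision of `K` along the simplex `σ`, with new vertex `w`: the simplices that
contain `σ` are removed, and the simplices `τ ∪ {w}` with `σ ⊄ τ` and `τ ∪ σ ∈ K` are added. -/
def stellar {V : Type*} [DecidableEq V] (K : PreAbstractSimplicialComplex V) (σ : Finset V) (w : V) :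
    PreAbstractSimplicialComplex V where
  faces := {s | s ∈ K.faces ∧ ¬ σ ⊆ s} ∪
    {s | w ∈ s ∧ ¬ σ ⊆ s.erase w ∧ s.erase w ∪ σ ∈ K.faces}
  isRelLowerSet_faces := by
    rintro s (⟨hs, hσ⟩ | ⟨hw, hσ, hs⟩)
    · exact ⟨(K.isRelLowerSet_faces hs).1, fun t ht hne =>
        Or.inl ⟨(K.isRelLowerSet_faces hs).2 ht hne, fun h => hσ (h.trans ht)⟩⟩
    · refine ⟨⟨w, hw⟩, fun t ht hne => ?_⟩
      have hsub : t.erase w ⊆ s.erase w := Finset.erase_subset_erase w ht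
      have hσt : ¬ σ ⊆ t.erase w := fun h => hσ (h.trans hsub)
      by_cases hwt : w ∈ t
      · refine Or.inr ⟨hwt, hσt, (K.isRelLowerSet_faces hs).2
          (Finset.union_subset_union_left hsub) ?_⟩
        by_contra hem
        rw [Finset.not_nonempty_iff_eq_empty, Finset.union_eq_empty] at hem
        exact hσt (by rw [hem.2]; exact Finset.empty_subset _)
      · rw [Finset.erase_eq_of_notMem hwt] at hsub hσt
        exact Or.inl ⟨(K.isRelLowerSet_faces hs).2
          (hsub.trans Finset.subset_union_left) hne, hσt⟩

/-! ### Truncations of codimension 2 faces -/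

/-- `K` is the boundary complex of the polytope dual to `A`: its simplices correspond to the
nonempty faces of `A` with inclusions reversed (the empty simplex corresponds to `A` itself). Such a
simplicial complex exists exactly when the polytope `A` is simple. -/
abbrev DualIso (A : Set E) (K : PreAbstractSimplicialComplex ℕ) : Type _ :=
  Face A ≃o (Simplex K)ᵒᵈ

/-- The polytope `P'` is obtained from the polytope `P` by truncation of a face `G` of codimension
2: the complex `∂P'*` is the stellar subdivision of `∂P*` along the simplex of `G`. The complexes are
finite, so it is no restriction to label their vertices by natural numbers. -/
structure Truncation {n : ℕ} (P P' : ConvexPolytope E n) where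
  /-- the truncated face -/
  G : Face P.carrier
  codim_G : dim G.1 + 2 = n
  /-- the complex `∂P*` -/
  K : PreAbstractSimplicialComplex ℕ
  /-- the correspondence between the faces of `P` and the simplices of `K` -/
  e : DualIso P.carrier K
  /-- the new vertex -/
  w : ℕ
  w_new : {w} ∉ K.faces
  /-- the correspondence between the faces of `P'` and the simplices of the subdivision -/
  e' : DualIso P'.carrier (stellar K (OrderDual.ofDual (e G)).1 w)

namespace Truncation

variable {n : ℕ} {P P' : ConvexPolytope E n} (T : Truncation P P')

/-- The simplex of the truncated face. -/
def σ : Finset ℕ := (OrderDual.ofDual (T.e T.G)).1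

/-- The simplex of a face of the new polytope. -/
def simplex' (Q' : Face P'.carrier) : Finset ℕ := (OrderDual.ofDual (T.e' Q')).1

theorem simplex'_of_mem (Q' : Face P'.carrier) (h : T.w ∈ T.simplex' Q') :
    (T.simplex' Q').erase T.w ∪ T.σ = ∅ ∨ (T.simplex' Q').erase T.w ∪ T.σ ∈ T.K.faces := by
  rcases (OrderDual.ofDual (T.e' Q')).2 with h0 | (h1 | h2)
  · have h0' : T.simplex' Q' = ∅ := h0
    simp [h0'] at h
  · exact absurd ((T.K.isRelLowerSet_faces h1.1).2
      (Finset.singleton_subset_iff.mpr h) (Finset.singleton_nonempty _)) T.w_new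
  · exact Or.inr h2.2.2

theorem simplex'_of_notMem (Q' : Face P'.carrier) (h : T.w ∉ T.simplex' Q') :
    T.simplex' Q' = ∅ ∨ T.simplex' Q' ∈ T.K.faces := by
  rcases (OrderDual.ofDual (T.e' Q')).2 with h0 | (h1 | h2)
  · exact Or.inl h0
  · exact Or.inr h1.1
  · exact absurd h2.1 h

/-- The face `Q` of `P` from which the face `Q'` of `P'` arises. If `Q'` does not lie in the section
facet, its simplex is a simplex of `∂P*`, and `Q` is the face of that simplex: `Q'` is `Q`, unchanged
or truncated. If `Q'` lies in the section facet, which is `G × I`, its simplex is `τ ∪ {w}`, and `Q` is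
the face `τ ∪ σ`, contained in `G`: here `Q'` is `Q × I` (if `τ` and `σ` are disjoint) or a copy of `Q`
in one of the two ends of `G × I`. -/
def oldFace (Q' : Face P'.carrier) : Face P.carrier :=
  if h : T.w ∈ T.simplex' Q' then
    T.e.symm (OrderDual.toDual ⟨(T.simplex' Q').erase T.w ∪ T.σ, T.simplex'_of_mem Q' h⟩)
  else
    T.e.symm (OrderDual.toDual ⟨T.simplex' Q', T.simplex'_of_notMem Q' h⟩)

open scoped Classical in
/-- One step of the construction of the complexes `Δ(Q)`: if `G ∩ Q` is a face of codimension 2 of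
`Q`, so that `Q'` is the 2-truncation of `Q` along `G ∩ Q`, then
`Δ(Q') = Δ(Q) ∪ (Δ(G ∩ Q) ⋆ v)`, where `v` is the new vertex; otherwise `Δ(Q') = Δ(Q)`.
(A face `Q'` in the section facet has `Q ⊆ G`, so `G ∩ Q = Q` and the second case applies.) -/
def step (Δ : Face P.carrier → PreAbstractSimplicialComplex ℕ) (v : ℕ)
    (Q' : Face P'.carrier) : PreAbstractSimplicialComplex ℕ :=
  if h : (T.G.1 ∩ (T.oldFace Q').1).Nonempty then
    if dim (T.G.1 ∩ (T.oldFace Q').1) + 2 = dim (T.oldFace Q').1 then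
      Δ (T.oldFace Q') ⊔ cone (Δ (T.G.inter (T.oldFace Q') h)) v
    else Δ (T.oldFace Q')
  else Δ (T.oldFace Q')

end Truncation

/-! ### 2-truncated cubes and the complexes `Δ(Q)` -/

/-- The cube `[0, 1] ^ n`. -/
def unitCube (n : ℕ) : Set (EuclideanSpace ℝ (Fin n)) := {x | ∀ i, x i ∈ Set.Icc (0 : ℝ) 1}

/-- A sequence of `m` truncations of codimension 2 faces that leads from an `n`-dimensional
(combinatorial) cube to the polytope `P`. -/
inductive TruncationSequence {n : ℕ} : ConvexPolytope E n → ℕ → Type _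
  | cube (P : ConvexPolytope E n) (e : Face P.carrier ≃o Face (unitCube n)) :
      TruncationSequence P 0
  | truncate {P : ConvexPolytope E n} {m : ℕ} (S : TruncationSequence P m)
      (P' : ConvexPolytope E n) (T : Truncation P P') : TruncationSequence P' (m + 1)

/-- The complexes `Δ(Q)`, `Q` a face of `P`, built along the sequence of truncations; the vertex of
the section facet of the `(k + 1)`-st truncation is `k`. For a cube all of them have no vertices. -/
def TruncationSequence.Δ {n : ℕ} : {P : ConvexPolytope E n} → {m : ℕ} →
    TruncationSequence P m → Face P.carrier → PreAbstractSimplicialComplex ℕ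
  | _, _, .cube _ _ => fun _ => ⊥
  | _, _, .truncate (m := m) S _ T => T.step S.Δ m

/-- `P` is a 2-truncated cube. -/
def IsTwoTruncatedCube {n : ℕ} (P : ConvexPolytope E n) : Prop :=
  ∃ m : ℕ, Nonempty (TruncationSequence P m)

end TwoTruncatedCube

end

noncomputable section

namespace TwoTruncatedCube

variable {E : Type*} [NormedAddCommGroup E] [NormedSpace ℝ E]

/-! ### Faces of convex hulls of finite sets -/

/-! Let a truncation of `G` turn `P` into `P'`, and let the face `Q'` of `P'` arise from the face
`Q` of `P`. There are three possibilities (`Truncation.HPolynomial_cases`). Either `Q'` is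
combinatorially `Q`, and `H` does not change; or `Q'` is the prism `Q × I` in the section facet, `H`
is multiplied by `α + t` and `γ` does not change; or `Q'` is `Q` cut along `G ∩ Q`, of codimension 2
in `Q`, and `H(Q') = H(Q) + αt H(G ∩ Q)`, that is, `γ(Q') = γ(Q) + τ γ(G ∩ Q)`. Gluing the cone over
`Δ(G ∩ Q)` to `Δ(Q)` changes `f` in the same way (`fPolynomial_sup_cone`), provided that `Δ(G ∩ Q)`
is a subcomplex of `Δ(Q)`. Since every face of a cube has `γ = 1`, the equality `f = γ` follows by
induction.

Flagness needs more: `Δ(G ∩ Q)` has to be a full subcomplex of `Δ(Q)`. The induction therefore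
carries a stronger statement (`IsGammaFamily`): there is one graph `Γ` on all labels, every `Δ(Q)`
is the clique complex of `Γ` on a vertex set `W(Q)`, and `W(A ∩ B) = W(A) ∩ W(B)`. The new vertex is
joined in `Γ` to `W(G)`, and it is put into `W(Q')` exactly when `Q` is cut. Compatibility with
intersections then requires that `A ∩ B` is cut if and only if both `A` and `B` are
(`Truncation.cuts_iff_of_isGLB`). This holds because faces of `P` that meet pairwise have a common
point, i.e. `∂P*` is flag. Cubes have this Helly property, and subdividing an edge preserves it
(`IsFlag.stellar`).

A truncation is given only through order isomorphisms between faces and simplices, so dimensions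
have to be read off from the order. The face poset of a polytope is graded by dimension
(`IsPolytope.dim_covBy`), whence `dim Q + |σ_Q| = n`. Thus `H(Q)` becomes a weighted count of the
simplices that contain `σ_Q` (`starSum`), and the effect of a stellar subdivision on such a count is
elementary. -/

/-- By Krein–Milman `B` is the closed hull of its extreme points; these are extreme in the whole
hull, hence lie in `S`. -/
theorem exposed_eq_convexHull {S : Finset E} {B : Set E}
    (hB : IsExposed ℝ (convexHull ℝ (S : Set E)) B) :
    B = convexHull ℝ ((S : Set E) ∩ B) := by
  have hfin : ((S : Set E) ∩ B).Finite := S.finite_toSet.subset Set.inter_subset_left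
  have hconv : Convex ℝ B := hB.convex (convex_convexHull ℝ _)
  refine subset_antisymm ?_ (convexHull_min Set.inter_subset_right hconv)
  have hcomp : IsCompact B := hB.isCompact (S.finite_toSet.isCompact_convexHull ℝ)
  have hext : B.extremePoints ℝ ⊆ (S : Set E) ∩ B := fun x hx =>
    ⟨extremePoints_convexHull_subset (hB.isExtreme.extremePoints_subset_extremePoints hx), hx.1⟩
  calc B = closure (convexHull ℝ (B.extremePoints ℝ)) :=
        (closure_convexHull_extremePoints hcomp hconv).symm
    _ ⊆ convexHull ℝ ((S : Set E) ∩ B) :=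
        closure_minimal (convexHull_mono hext) (hfin.isClosed_convexHull ℝ)

/-- The convex hull of a finite set. -/
def IsPolytope (A : Set E) : Prop := ∃ S : Finset E, A = convexHull ℝ (S : Set E)

theorem IsPolytope.of_isExposed {A B : Set E} (hA : IsPolytope A) (hB : IsExposed ℝ A B) :
    IsPolytope B := by
  classical
  obtain ⟨S, rfl⟩ := hA
  refine ⟨S.filter (· ∈ B), ?_⟩
  rw [Finset.coe_filter]
  exact exposed_eq_convexHull hB

theorem ConvexPolytope.isPolytope {n : ℕ} (P : ConvexPolytope E n) : IsPolytope P.carrier := by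
  obtain ⟨S, -, h⟩ := P.isHull
  exact ⟨S, h⟩

theorem IsPolytope.finite_face {A : Set E} (hA : IsPolytope A) : Finite (Face A) := by
  obtain ⟨S, rfl⟩ := hA
  have hinj : Function.Injective
      (fun B : Face (convexHull ℝ (S : Set E)) =>
        (⟨(S : Set E) ∩ B.1, Set.inter_subset_left⟩ : Set.powerset (S : Set E))) := by
    intro B C h
    have h' : (S : Set E) ∩ B.1 = (S : Set E) ∩ C.1 := congrArg Subtype.val h
    apply Subtype.ext
    rw [exposed_eq_convexHull B.2.2, exposed_eq_convexHull C.2.2, h']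
  have : Finite (Set.powerset (S : Set E)) := S.finite_toSet.finite_subsets
  exact Finite.of_injective _ hinj

/-- If `l` exposes `B` and `l'` exposes `C` in `B`, then `N • l + l'` exposes `C` in `A` for large
`N`. Finiteness of the generating set provides one `N` that works for all generators outside `B`;
for general convex sets a face of a face need not be exposed. -/
theorem IsPolytope.isExposed_trans {A B C : Set E} (hA : IsPolytope A) (hB : IsExposed ℝ A B)
    (hC : IsExposed ℝ B C) : IsExposed ℝ A C := by
  obtain ⟨S, rfl⟩ := hA
  rcases Set.eq_empty_or_nonempty C with rfl | hne
  · exact isExposed_empty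
  obtain ⟨c, hc⟩ := hne
  have hcB := hC.subset hc
  have hCconv : Convex ℝ C := hC.convex (hB.convex (convex_convexHull ℝ _))
  obtain ⟨l, hl⟩ := hB ⟨c, hcB⟩
  obtain ⟨l', hl'⟩ := hC ⟨c, hc⟩
  have hlB : ∀ x ∈ B, l x = l c := by
    intro x hx
    have h1 := hcB
    rw [hl] at hx h1
    exact le_antisymm (h1.2 x hx.1) (hx.2 c h1.1)
  have hlt : ∀ v ∈ S, v ∉ B → l v < l c := by
    intro v hv hvB
    by_contra hle
    apply hvB
    have h1 := hcB
    rw [hl] at h1 ⊢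
    exact ⟨subset_convexHull ℝ _ hv, fun y hy => (h1.2 y hy).trans (not_lt.mp hle)⟩
  have hlC : ∀ x ∈ B, l' x ≤ l' c := by
    have h1 := hc
    rw [hl'] at h1
    exact h1.2
  have hev : ∀ᶠ N : ℝ in Filter.atTop, ∀ v ∈ S, v ∉ B →
      N * l v + l' v < N * l c + l' c := by
    rw [Filter.eventually_all_finset]
    intro v hv
    by_cases hvB : v ∈ B
    · exact Filter.Eventually.of_forall fun _ h => absurd hvB h
    filter_upwards [Filter.eventually_gt_atTop ((l' v - l' c) / (l c - l v))] with N hN _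
    have hpos : 0 < l c - l v := sub_pos.mpr (hlt v hv hvB)
    rw [div_lt_iff₀ hpos] at hN
    linarith
  obtain ⟨N, hN⟩ := hev.exists
  set f : StrongDual ℝ E := N • l + l' with hf
  have hfapp : ∀ x, f x = N * l x + l' x := fun x => by simp [hf]
  have hmaxS : ∀ v ∈ S, f v ≤ f c := by
    intro v hv
    rw [hfapp, hfapp]
    by_cases hvB : v ∈ B
    · rw [hlB v hvB]
      linarith [hlC v hvB]
    · exact (hN v hv hvB).le
  have hmax : ∀ x ∈ convexHull ℝ (S : Set E), f x ≤ f c := by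
    have : convexHull ℝ (S : Set E) ⊆ {x | f x ≤ f c} :=
      convexHull_min hmaxS (convex_halfSpace_le f.toLinearMap.isLinear _)
    exact this
  have hDexp : IsExposed ℝ (convexHull ℝ (S : Set E)) (f.toExposed (convexHull ℝ (S : Set E))) :=
    ContinuousLinearMap.toExposed.isExposed
  have hCD : C = f.toExposed (convexHull ℝ (S : Set E)) := by
    apply subset_antisymm
    · intro x hx
      have hxB := hC.subset hx
      refine ⟨hB.subset hxB, fun y hy => (hmax y hy).trans ?_⟩
      rw [hfapp, hfapp, hlB x hxB]
      rw [hl'] at hx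
      linarith [hx.2 c hcB]
    · rw [exposed_eq_convexHull hDexp]
      refine convexHull_min ?_ hCconv
      rintro v ⟨hv, hvD⟩
      have h1 : f c ≤ f v := hvD.2 c (hB.subset hcB)
      have hvB : v ∈ B := by
        by_contra hvB
        have := hN v hv hvB
        rw [hfapp, hfapp] at h1
        linarith
      rw [hfapp, hfapp, hlB v hvB] at h1
      rw [hl']
      exact ⟨hvB, fun y hy => (hlC y hy).trans (by linarith)⟩
  rw [hCD]
  exact hDexp

/-! ### Dimensions of faces -/

theorem vectorSpan_le_ker {A : Set E} (f : E →ₗ[ℝ] ℝ) {b : E} (h : ∀ x ∈ A, f x = f b) :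
    vectorSpan ℝ A ≤ LinearMap.ker f := by
  rw [vectorSpan, Submodule.span_le]
  rintro _ ⟨x, hx, y, hy, rfl⟩
  simp [h x hx, h y hy]

theorem dim_le_of_subset [FiniteDimensional ℝ E] {A B : Set E} (h : B ⊆ A) : dim B ≤ dim A :=
  Submodule.finrank_mono (vectorSpan_mono ℝ h)

/-- If the directions of `A` were those of `B`, the functional that exposes `B` would be constant on
`A`. -/
theorem dim_lt_of_isExposed [FiniteDimensional ℝ E] {A B : Set E} (hB : IsExposed ℝ A B)
    (hne : B.Nonempty) (hlt : B ≠ A) : dim B < dim A := by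
  obtain ⟨l, hl⟩ := hB hne
  obtain ⟨b, hb⟩ := hne
  apply Submodule.finrank_lt_finrank_of_lt
  refine lt_of_le_of_ne (vectorSpan_mono ℝ hB.subset) fun heq => hlt ?_
  refine subset_antisymm hB.subset fun x hx => ?_
  have hconst : ∀ y ∈ B, l y = l b := by
    intro y hy
    have h1 := hb
    rw [hl] at hy h1
    exact le_antisymm (h1.2 y hy.1) (hy.2 b h1.1)
  have hker := vectorSpan_le_ker l.toLinearMap hconst
  rw [heq] at hker
  have hxb : l (x - b) = 0 := hker (vsub_mem_vectorSpan ℝ hx (hB.subset hb))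
  have hxb' : l x = l b := by rwa [map_sub, sub_eq_zero] at hxb
  have h1 := hb
  rw [hl] at h1 ⊢
  exact ⟨hx, fun y hy => hxb' ▸ h1.2 y hy⟩

/-- Between a polytope and a face of codimension at least two there is an intermediate face. -/
theorem IsPolytope.exists_between [FiniteDimensional ℝ E] {A B : Set E} (hA : IsPolytope A)
    (hB : IsExposed ℝ A B) (hne : B.Nonempty) (hdim : dim B + 2 ≤ dim A) :
    ∃ D, IsExposed ℝ A D ∧ B ⊂ D ∧ D ⊂ A := by
  classical
  obtain ⟨S, rfl⟩ := hA
  obtain ⟨l, hl⟩ := hB hne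
  obtain ⟨b, hb⟩ := hne
  set A := convexHull ℝ (S : Set E) with hAdef
  have hbA := hB.subset hb
  have hconst : ∀ y ∈ B, l y = l b := by
    intro y hy
    have h1 := hb
    rw [hl] at hy h1
    exact le_antisymm (h1.2 y hy.1) (hy.2 b h1.1)
  have hlt : ∀ v ∈ S, v ∉ B → l v < l b := by
    intro v hv hvB
    by_contra hle
    apply hvB
    have h1 := hb
    rw [hl] at h1 ⊢
    exact ⟨subset_convexHull ℝ _ hv, fun y hy => (h1.2 y hy).trans (not_lt.mp hle)⟩
  -- a direction of `A` in the kernel of `l` which is not a direction of `B`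
  obtain ⟨x, hxA, hxl, hxB⟩ : ∃ x ∈ vectorSpan ℝ A, l x = 0 ∧ x ∉ vectorSpan ℝ B := by
    by_contra hcon
    push Not at hcon
    have hle : vectorSpan ℝ A ⊓ LinearMap.ker l.toLinearMap ≤ vectorSpan ℝ B :=
      fun x hx => hcon x hx.1 hx.2
    have h1 := Submodule.finrank_mono hle
    have h2 := Submodule.finrank_sup_add_finrank_inf_eq (vectorSpan ℝ A)
      (LinearMap.ker l.toLinearMap)
    have h3 := LinearMap.finrank_range_add_finrank_ker l.toLinearMap
    have h4 := (LinearMap.range l.toLinearMap).finrank_le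
    have h5 := (vectorSpan ℝ A ⊔ LinearMap.ker l.toLinearMap).finrank_le
    rw [Module.finrank_self] at h4
    unfold dim at hdim
    omega
  -- The hyperplane of `l` will be turned about `B` by adding a multiple of a functional that is
  -- constant on `B` but not on `A`.
  obtain ⟨g₀, hg₀x, hg₀B⟩ := Submodule.exists_le_ker_of_notMem hxB
  have hkey : ∀ f : E →ₗ[ℝ] ℝ, f x ≠ 0 → ∃ v ∈ S, f v ≠ f b := by
    intro f hfx
    by_contra hcon
    push Not at hcon
    have h1 : vectorSpan ℝ A ≤ LinearMap.ker f := by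
      refine vectorSpan_le_ker f (b := b) ?_
      have : A ⊆ {x | f x = f b} := convexHull_min hcon (convex_hyperplane f.isLinear _)
      exact this
    exact hfx (h1 hxA)
  obtain ⟨g, hgx, hgB, v₀, hv₀, hgv₀⟩ : ∃ g : E →ₗ[ℝ] ℝ, g x ≠ 0 ∧
      vectorSpan ℝ B ≤ LinearMap.ker g ∧ ∃ v ∈ S, g b < g v := by
    obtain ⟨v, hv, hvb⟩ := hkey g₀ hg₀x
    rcases lt_or_gt_of_ne hvb with h | h
    · refine ⟨-g₀, by simpa using hg₀x, fun y hy => ?_, v, hv, by simpa using h⟩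
      simpa using hg₀B hy
    · exact ⟨g₀, hg₀x, hg₀B, v, hv, h⟩
  have hgconst : ∀ y ∈ B, g y = g b := by
    intro y hy
    have : g (y - b) = 0 := hgB (vsub_mem_vectorSpan ℝ hy hb)
    rwa [map_sub, sub_eq_zero] at this
  set S' := S.filter (fun v => g b < g v) with hS'
  have hS'ne : S'.Nonempty := ⟨v₀, Finset.mem_filter.mpr ⟨hv₀, hgv₀⟩⟩
  -- The minimal ratio is the first moment at which the turning hyperplane meets a new generator
  -- `v₁`; up to then it still supports `A` along `B`.
  obtain ⟨v₁, hv₁, hmin⟩ := S'.exists_min_image (fun v => (l b - l v) / (g v - g b)) hS'ne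
  rw [hS', Finset.mem_filter] at hv₁
  have hv₁B : v₁ ∉ B := fun h => hv₁.2.ne' (hgconst v₁ h)
  have hd₁ : 0 < g v₁ - g b := sub_pos.mpr hv₁.2
  set t := (l b - l v₁) / (g v₁ - g b) with ht
  have htpos : 0 < t := div_pos (sub_pos.mpr (hlt v₁ hv₁.1 hv₁B)) hd₁
  set f : StrongDual ℝ E := l + t • LinearMap.toContinuousLinearMap g with hf
  have hfapp : ∀ y, f y = l y + t * g y := fun y => by simp [hf]
  have hmaxS : ∀ v ∈ S, f v ≤ f b := by
    intro v hv
    rw [hfapp, hfapp]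
    by_cases hgv : g b < g v
    · have h1 := hmin v (Finset.mem_filter.mpr ⟨hv, hgv⟩)
      change t ≤ _ at h1
      rw [le_div_iff₀ (sub_pos.mpr hgv)] at h1
      linarith
    · have h1 : l v ≤ l b := by
        by_cases hvB : v ∈ B
        · exact (hconst v hvB).le
        · exact (hlt v hv hvB).le
      have h2 : t * g v ≤ t * g b := mul_le_mul_of_nonneg_left (not_lt.mp hgv) htpos.le
      linarith
  have hmax : ∀ y ∈ A, f y ≤ f b := by
    have : A ⊆ {x | f x ≤ f b} :=
      convexHull_min hmaxS (convex_halfSpace_le f.toLinearMap.isLinear _)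
    exact this
  have hfv₁ : f v₁ = f b := by
    rw [hfapp, hfapp]
    have : t * (g v₁ - g b) = l b - l v₁ := div_mul_cancel₀ _ hd₁.ne'
    linarith
  -- Since `l x = 0`, the value `f x = t * g x` is nonzero. So `f` is not constant on `A` and
  -- exposes a proper face.
  obtain ⟨v₂, hv₂, hfv₂⟩ := hkey f.toLinearMap (by
    change f x ≠ 0
    rw [hfapp, hxl, zero_add]
    exact mul_ne_zero htpos.ne' hgx)
  refine ⟨f.toExposed A, ContinuousLinearMap.toExposed.isExposed, ?_, ?_⟩
  · refine ssubset_of_subset_of_ne ?_ fun h => hv₁B ?_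
    · intro y hy
      refine ⟨hB.subset hy, fun z hz => (hmax z hz).trans ?_⟩
      rw [hfapp, hfapp, hconst y hy, hgconst y hy]
    · rw [h]
      exact ⟨subset_convexHull ℝ _ hv₁.1, fun z hz => hfv₁ ▸ hmax z hz⟩
  · refine ssubset_of_subset_of_ne (fun y hy => hy.1) fun h => hfv₂ ?_
    have hv₂A : v₂ ∈ A := subset_convexHull ℝ _ hv₂
    have : v₂ ∈ f.toExposed A := by rw [h]; exact hv₂A
    exact le_antisymm (hmaxS v₂ hv₂) (this.2 b hbA)

theorem Face.isExposed_of_le {A : Set E} {B C : Face A} (h : B ≤ C) : IsExposed ℝ C.1 B.1 :=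
  B.2.2.mono C.2.2.subset h

theorem Face.dim_mono [FiniteDimensional ℝ E] {A : Set E} {B C : Face A} (h : B ≤ C) :
    dim B.1 ≤ dim C.1 :=
  dim_le_of_subset h

theorem Face.dim_strictMono [FiniteDimensional ℝ E] {A : Set E} {B C : Face A} (h : B < C) :
    dim B.1 < dim C.1 :=
  dim_lt_of_isExposed (Face.isExposed_of_le h.le) B.2.1 fun heq => h.ne (Subtype.ext heq)

/-- The face poset of a polytope is graded by dimension. -/
theorem IsPolytope.dim_covBy [FiniteDimensional ℝ E] {A : Set E} (hA : IsPolytope A) {B C : Face A}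
    (h : B ⋖ C) : dim B.1 + 1 = dim C.1 := by
  have h1 := Face.dim_strictMono h.lt
  by_contra hne
  obtain ⟨D, hD, hBD, hDC⟩ := (hA.of_isExposed C.2.2).exists_between
    (Face.isExposed_of_le h.le) B.2.1 (by omega)
  exact h.2 (c := ⟨D, B.2.1.mono hBD.subset, hA.isExposed_trans C.2.2 hD⟩) hBD hDC

/-- The faces of a face `Q` are the faces of the polytope contained in `Q`. -/
def IsPolytope.faceEquiv {A : Set E} (hA : IsPolytope A) (Q : Face A) :
    Face Q.1 ≃ {B : Face A // B ≤ Q} where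
  toFun B := ⟨⟨B.1, B.2.1, hA.isExposed_trans Q.2.2 B.2.2⟩, B.2.2.subset⟩
  invFun B := ⟨B.1.1, B.1.2.1, Face.isExposed_of_le B.2⟩
  left_inv _ := rfl
  right_inv _ := rfl

/-- The polynomial `H` of a face as a sum over the faces that it contains. -/
theorem IsPolytope.HPolynomial_eq [FiniteDimensional ℝ E] {A : Set E} (hA : IsPolytope A)
    [Fintype (Face A)] [DecidableLE (Face A)] (Q : Face A) :
    HPolynomial Q.1 = ∑ B : Face A with B ≤ Q,
      (MvPolynomial.X 0 - MvPolynomial.X 1) ^ dim B.1 *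
        MvPolynomial.X 1 ^ (dim Q.1 - dim B.1) := by
  classical
  have hmap : ∀ B ∈ (Finset.univ.filter (· ≤ Q) : Finset (Face A)),
      dim B.1 ∈ Finset.range (dim Q.1 + 1) := by
    intro B hB
    rw [Finset.mem_filter] at hB
    exact Finset.mem_range_succ_iff.mpr (Face.dim_mono hB.2)
  have hcard : ∀ i, faceNumber Q.1 i =
      ((Finset.univ.filter (· ≤ Q) : Finset (Face A)).filter (fun B => dim B.1 = i)).card := by
    intro i
    rw [Finset.filter_filter, ← Fintype.card_subtype, ← Nat.card_eq_fintype_card, faceNumber]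
    exact Nat.card_congr
      { toFun := fun B => ⟨(hA.faceEquiv Q B.1).1, (hA.faceEquiv Q B.1).2, B.2⟩
        invFun := fun B => ⟨(hA.faceEquiv Q).symm ⟨B.1, B.2.1⟩, B.2.2⟩
        left_inv := fun _ => rfl
        right_inv := fun _ => rfl }
  rw [HPolynomial, FPolynomial, map_sum, ← Finset.sum_fiberwise_of_maps_to hmap]
  refine Finset.sum_congr rfl fun i _ => ?_
  rw [Finset.sum_congr rfl (g := fun _ => (MvPolynomial.X 0 - MvPolynomial.X 1) ^ i *
        MvPolynomial.X 1 ^ (dim Q.1 - i)), Finset.sum_const, hcard]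
  · simp [mul_assoc]
  · intro B hB
    rw [(Finset.mem_filter.mp hB).2]

/-! ### Simplices of a complex and of its stellar subdivision along an edge -/

/-- `s` is a simplex of `K`, possibly the empty one. -/
def IsSimplex {V : Type*} (K : PreAbstractSimplicialComplex V) (s : Finset V) : Prop :=
  s = ∅ ∨ s ∈ K.faces

section Complex

variable {V : Type*} {K : PreAbstractSimplicialComplex V}

theorem IsSimplex.mono {s t : Finset V} (ht : IsSimplex K t) (h : s ⊆ t) : IsSimplex K s := by
  rcases s.eq_empty_or_nonempty with rfl | hne
  · exact Or.inl rfl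
  · rcases ht with rfl | ht
    · exact absurd (Finset.subset_empty.mp h) hne.ne_empty
    · exact Or.inr ((K.isRelLowerSet_faces ht).2 h hne)

theorem IsSimplex.mem_faces {s : Finset V} (h : IsSimplex K s) (hne : s.Nonempty) : s ∈ K.faces :=
  h.resolve_left hne.ne_empty

theorem IsSimplex.notMem {s : Finset V} (h : IsSimplex K s) {w : V} (hw : {w} ∉ K.faces) :
    w ∉ s := fun hws =>
  hw ((h.mono (Finset.singleton_subset_iff.mpr hws)).mem_faces (Finset.singleton_nonempty w))

variable [DecidableEq V]

theorem isSimplex_stellar_iff {σ : Finset V} (hσ : σ.Nonempty) {w : V} {s : Finset V} :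
    IsSimplex (stellar K σ w) s ↔ (IsSimplex K s ∧ ¬ σ ⊆ s) ∨
      (w ∈ s ∧ ¬ σ ⊆ s.erase w ∧ IsSimplex K (s.erase w ∪ σ)) := by
  have hne : ∀ t : Finset V, IsSimplex K (t ∪ σ) ↔ t ∪ σ ∈ K.faces := fun t =>
    ⟨fun h => h.mem_faces (hσ.mono Finset.subset_union_right), Or.inr⟩
  rw [hne]
  constructor
  · rintro (rfl | ⟨h1, h2⟩ | h)
    · exact Or.inl ⟨Or.inl rfl, fun h => hσ.ne_empty (Finset.subset_empty.mp h)⟩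
    · exact Or.inl ⟨Or.inr h1, h2⟩
    · exact Or.inr h
  · rintro (⟨rfl | h1, h2⟩ | h)
    · exact Or.inl rfl
    · exact Or.inr (Or.inl ⟨h1, h2⟩)
    · exact Or.inr (Or.inr h)

theorem IsFlag.isSimplex (hK : IsFlag K) {s : Finset V}
    (h : ∀ u ∈ s, ∀ v ∈ s, IsSimplex K {u, v}) : IsSimplex K s := by
  rcases s.eq_empty_or_nonempty with rfl | hne
  · exact Or.inl rfl
  · refine Or.inr (hK s hne (fun v hv => ?_) fun u hu v hv _ =>
      (h u hu v hv).mem_faces (Finset.insert_nonempty _ _))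
    simpa using (h v hv v hv).mem_faces (Finset.insert_nonempty _ _)

/-- In a flag complex three simplices that are pairwise contained in a common simplex are contained
in a common simplex. -/
theorem IsFlag.isSimplex_union (hK : IsFlag K) {p q r : Finset V} (hpq : IsSimplex K (p ∪ q))
    (hqr : IsSimplex K (q ∪ r)) (hpr : IsSimplex K (p ∪ r)) : IsSimplex K (p ∪ q ∪ r) := by
  refine hK.isSimplex fun u hu v hv => ?_
  simp only [Finset.mem_union] at hu hv
  have key : ∀ t, IsSimplex K t → u ∈ t → v ∈ t → IsSimplex K {u, v} := fun t ht h1 h2 =>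
    ht.mono (Finset.insert_subset h1 (Finset.singleton_subset_iff.mpr h2))
  rcases hu with (hu | hu) | hu <;> rcases hv with (hv | hv) | hv
  · exact key _ hpq (by simp [hu]) (by simp [hv])
  · exact key _ hpq (by simp [hu]) (by simp [hv])
  · exact key _ hpr (by simp [hu]) (by simp [hv])
  · exact key _ hpq (by simp [hu]) (by simp [hv])
  · exact key _ hpq (by simp [hu]) (by simp [hv])
  · exact key _ hqr (by simp [hu]) (by simp [hv])
  · exact key _ hpr (by simp [hu]) (by simp [hv])
  · exact key _ hqr (by simp [hu]) (by simp [hv])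
  · exact key _ hpr (by simp [hu]) (by simp [hv])

/-- Converse of `IsFlag.isSimplex_union`. A clique `s` with distinct vertices `x`, `y` is the union
of `{x}`, `{y}` and the rest; the pairwise unions are the edge `{x, y}` and the smaller cliques
`s.erase x` and `s.erase y`. -/
theorem isFlag_of_isSimplex_union (h : ∀ p q r, IsSimplex K (p ∪ q) → IsSimplex K (q ∪ r) →
    IsSimplex K (p ∪ r) → IsSimplex K (p ∪ q ∪ r)) : IsFlag K := by
  intro s
  induction s using Finset.strongInduction with
  | H s ih =>
    intro hne hv he
    by_cases hcard : s.card ≤ 1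
    · obtain ⟨x, hx⟩ := hne
      have : s = {x} := Finset.eq_singleton_iff_unique_mem.mpr
        ⟨hx, fun y hy => Finset.card_le_one.mp hcard y hy x hx⟩
      rw [this]
      exact hv x hx
    · obtain ⟨x, hx, y, hy, hxy⟩ := Finset.one_lt_card.mp (not_le.mp hcard)
      have hx' : s.erase x ∈ K.faces := ih _ (Finset.erase_ssubset hx)
        ⟨y, Finset.mem_erase.mpr ⟨hxy.symm, hy⟩⟩
        (fun v h => hv v (Finset.mem_of_mem_erase h))
        (fun u hu v hv => he u (Finset.mem_of_mem_erase hu) v (Finset.mem_of_mem_erase hv))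
      have hy' : s.erase y ∈ K.faces := ih _ (Finset.erase_ssubset hy)
        ⟨x, Finset.mem_erase.mpr ⟨hxy, hx⟩⟩
        (fun v h => hv v (Finset.mem_of_mem_erase h))
        (fun u hu v hv => he u (Finset.mem_of_mem_erase hu) v (Finset.mem_of_mem_erase hv))
      have := h {x} {y} ((s.erase x).erase y) (Or.inr (he x hx y hy hxy))
        (IsSimplex.mono (Or.inr hx') (by clear * - hy hxy; grind))
        (IsSimplex.mono (Or.inr hy') (by clear * - hx hxy; grind))
      have heq : {x} ∪ {y} ∪ (s.erase x).erase y = s := by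
        clear * - hx hy
        grind
      rw [heq] at this
      exact this.mem_faces hne

/-- Away from `w`, a clique of the subdivision is a clique of `K` that misses `a` or `b`, because
the edge `{a, b}` has disappeared. If it contains `w`, each of its other vertices spans a simplex of
`K` with `{a, b}`, so adding `a` and `b` still gives a clique of `K`. -/
theorem IsFlag.stellar (hK : IsFlag K) {a b w : V}
    (hσ : ({a, b} : Finset V) ∈ K.faces) (hw : {w} ∉ K.faces) :
    IsFlag (stellar K {a, b} w) := by
  have hσne : ({a, b} : Finset V).Nonempty := Finset.insert_nonempty _ _
  have hwσ : w ∉ ({a, b} : Finset V) := IsSimplex.notMem (Or.inr hσ) hw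
  intro s hne hv he
  have he' : ∀ u ∈ s, ∀ v ∈ s, IsSimplex (TwoTruncatedCube.stellar K {a, b} w) {u, v} := by
    intro u hu v hv'
    by_cases huv : u = v
    · subst huv
      rw [Finset.pair_eq_singleton]
      exact Or.inr (hv u hu)
    · exact Or.inr (he u hu v hv' huv)
  simp only [isSimplex_stellar_iff hσne] at he'
  have hpair : ∀ u ∈ s, u ≠ w → ∀ v ∈ s, v ≠ w →
      IsSimplex K {u, v} ∧ ¬ ({a, b} : Finset V) ⊆ {u, v} := by
    intro u hu huw v hv' hvw
    rcases he' u hu v hv' with h | h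
    · exact h
    · have := h.1
      simp only [Finset.mem_insert, Finset.mem_singleton] at this
      rcases this with h | h
      · exact absurd h.symm huw
      · exact absurd h.symm hvw
  have hτ : IsSimplex K (s.erase w) := hK.isSimplex fun u hu v hv' =>
    (hpair u (Finset.mem_of_mem_erase hu) (Finset.ne_of_mem_erase hu) v
      (Finset.mem_of_mem_erase hv') (Finset.ne_of_mem_erase hv')).1
  have hστ : ¬ ({a, b} : Finset V) ⊆ s.erase w := by
    intro hsub
    have ha : a ∈ s.erase w := hsub (by simp)
    have hb : b ∈ s.erase w := hsub (by simp)
    exact (hpair a (Finset.mem_of_mem_erase ha) (Finset.ne_of_mem_erase ha) b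
      (Finset.mem_of_mem_erase hb) (Finset.ne_of_mem_erase hb)).2 subset_rfl
  have hmem : IsSimplex (TwoTruncatedCube.stellar K {a, b} w) s := by
    rw [isSimplex_stellar_iff hσne]
    by_cases hws : w ∈ s
    · refine Or.inr ⟨hws, hστ, hK.isSimplex ?_⟩
      have hlink : ∀ u ∈ s.erase w, IsSimplex K ({u} ∪ {a, b}) := by
        intro u hu
        have huw := Finset.ne_of_mem_erase hu
        rcases he' u (Finset.mem_of_mem_erase hu) w hws with h | h
        · exact absurd (by simp) (h.1.notMem hw)
        · have h2 := h.2.2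
          have : ({u, w} : Finset V).erase w = {u} := by
            rw [Finset.pair_comm, Finset.erase_insert (by simpa using huw.symm)]
          rwa [this] at h2
      intro u hu v hv'
      rw [Finset.mem_union] at hu hv'
      rcases hu with hu | hu <;> rcases hv' with hv' | hv'
      · exact hτ.mono (Finset.insert_subset hu (Finset.singleton_subset_iff.mpr hv'))
      · exact (hlink u hu).mono (Finset.insert_subset (by simp)
          (Finset.singleton_subset_iff.mpr (Finset.mem_union_right _ hv')))
      · exact (hlink v hv').mono (Finset.insert_subset (Finset.mem_union_right _ hu)
          (by simp))
      · exact IsSimplex.mono (Or.inr hσ)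
          (Finset.insert_subset hu (Finset.singleton_subset_iff.mpr hv'))
    · rw [Finset.erase_eq_of_notMem hws] at hτ hστ
      exact Or.inl ⟨hτ, hστ⟩
  exact hmem.mem_faces hne

theorem erase_insert_sdiff_union {u c : Finset V} {w : V} (hw : w ∉ u) (hc : c ⊆ u) :
    (insert w (u \ c)).erase w ∪ c = u := by
  rw [Finset.erase_insert (fun h => hw (Finset.mem_sdiff.mp h).1), Finset.sdiff_union_of_subset hc]

/-- A sum over the simplices of a stellar subdivision along an edge. -/
theorem sum_stellar {M : Type*} [AddCommMonoid M] {a b w : V} (hab : a ≠ b)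
    (hw : {w} ∉ K.faces) {L L' : Finset (Finset V)} (hL : ∀ s, s ∈ L ↔ IsSimplex K s)
    (hL' : ∀ s, s ∈ L' ↔ IsSimplex (stellar K {a, b} w) s) (g : Finset V → M) :
    ∑ s ∈ L', g s = ∑ u ∈ L with ¬ ({a, b} : Finset V) ⊆ u, g u +
      ∑ u ∈ L with {a, b} ⊆ u, (g (insert w (u \ {a})) + g (insert w (u \ {b})) +
        g (insert w (u \ {a, b}))) := by
  have hσne : ({a, b} : Finset V).Nonempty := Finset.insert_nonempty _ _
  have hwL : ∀ u ∈ L, w ∉ u := fun u hu => ((hL u).mp hu).notMem hw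
  set N := L.filter (fun u => ({a, b} : Finset V) ⊆ u) with hN
  have hwN : ∀ u ∈ N, w ∉ u := fun u hu => hwL u (Finset.mem_filter.mp hu).1
  have hσN : ∀ u ∈ N, {a, b} ⊆ u := fun u hu => (Finset.mem_filter.mp hu).2
  -- A simplex `s` with `w ∈ s` comes from `u = s.erase w ∪ {a, b}` by replacing a nonempty `c ⊆ {a,
  -- b}` with `w`. Both `u` and `c`, the part of `{a, b}` missing from `s`, are determined by `s`.
  have hset : L' = L.filter (fun u => ¬ ({a, b} : Finset V) ⊆ u) ∪
      (N.image (fun u => insert w (u \ {a})) ∪ N.image (fun u => insert w (u \ {b})) ∪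
        N.image (fun u => insert w (u \ {a, b}))) := by
    ext s
    rw [hL', isSimplex_stellar_iff hσne]
    simp only [Finset.mem_union, Finset.mem_image]
    rw [Finset.mem_filter, hL]
    refine or_congr Iff.rfl ⟨?_, ?_⟩
    · rintro ⟨hws, hσ, hs⟩
      have hmem : s.erase w ∪ {a, b} ∈ N :=
        Finset.mem_filter.mpr ⟨(hL _).mpr hs, Finset.subset_union_right⟩
      have key : ∀ c : Finset V, (s.erase w ∪ {a, b}) \ c = s.erase w →
          insert w ((s.erase w ∪ {a, b}) \ c) = s := fun c h => by
        rw [h, Finset.insert_erase hws]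
      generalize hτ : s.erase w = τ at *
      by_cases ha : a ∈ τ
      · have hb : b ∉ τ := fun hb =>
          hσ (Finset.insert_subset ha (Finset.singleton_subset_iff.mpr hb))
        exact Or.inl (Or.inr ⟨_, hmem, key _ (by clear * - ha hb; grind)⟩)
      · by_cases hb : b ∈ τ
        · exact Or.inl (Or.inl ⟨_, hmem, key _ (by clear * - ha hb; grind)⟩)
        · exact Or.inr ⟨_, hmem, key _ (by clear * - ha hb; grind)⟩
    · have key : ∀ u ∈ N, ∀ c ⊆ ({a, b} : Finset V), c.Nonempty → insert w (u \ c) = s →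
          w ∈ s ∧ ¬ ({a, b} : Finset V) ⊆ s.erase w ∧ IsSimplex K (s.erase w ∪ {a, b}) := by
        rintro u hu c hc ⟨x, hx⟩ rfl
        have hwu := hwN u hu
        rw [Finset.erase_insert (fun h => hwu (Finset.mem_sdiff.mp h).1)]
        refine ⟨Finset.mem_insert_self _ _,
          fun h => (Finset.mem_sdiff.mp (h (hc hx))).2 hx,
          ((hL u).mp (Finset.mem_filter.mp hu).1).mono
            (Finset.union_subset Finset.sdiff_subset (hσN u hu))⟩
      rintro ((⟨u, hu, h⟩ | ⟨u, hu, h⟩) | ⟨u, hu, h⟩)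
      · exact key u hu _ (by simp) (by simp) h
      · exact key u hu _ (by simp) (by simp) h
      · exact key u hu _ subset_rfl (by simp) h
  have hinj : ∀ c ⊆ ({a, b} : Finset V), Set.InjOn (fun u => insert w (u \ c)) N := by
    intro c hc u hu v hv h
    rw [← erase_insert_sdiff_union (hwN u hu) (hc.trans (hσN u hu)),
      ← erase_insert_sdiff_union (hwN v hv) (hc.trans (hσN v hv))]
    exact congrArg (fun s => s.erase w ∪ c) h
  have hdisj : ∀ (c d : Finset V) (x : V), x ∈ ({a, b} : Finset V) → x ∉ c → x ∈ d →
      Disjoint (N.image (fun u => insert w (u \ c))) (N.image (fun u => insert w (u \ d))) := by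
    intro c d x hx hxc hxd
    rw [Finset.disjoint_left]
    intro s hs hs'
    obtain ⟨u, hu, rfl⟩ := Finset.mem_image.mp hs
    obtain ⟨v, hv, h⟩ := Finset.mem_image.mp hs'
    have hxu : x ∈ insert w (u \ c) :=
      Finset.mem_insert_of_mem (Finset.mem_sdiff.mpr ⟨hσN u hu hx, hxc⟩)
    rw [← h, Finset.mem_insert, Finset.mem_sdiff] at hxu
    rcases hxu with rfl | hxu
    · exact hwN u hu (hσN u hu hx)
    · exact hxu.2 hxd
  rw [hset, Finset.sum_union, Finset.sum_union, Finset.sum_union,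
    Finset.sum_image (hinj _ (by simp)), Finset.sum_image (hinj _ (by simp)),
    Finset.sum_image (hinj _ subset_rfl), Finset.sum_add_distrib, Finset.sum_add_distrib]
  · exact hdisj _ _ b (by simp) (by simpa using hab.symm) (by simp)
  · rw [Finset.disjoint_union_left]
    exact ⟨hdisj _ _ b (by simp) (by simpa using hab.symm) (by simp),
      hdisj _ _ a (by simp) (by simpa using hab) (by simp)⟩
  · rw [Finset.disjoint_left]
    intro s hs hs'
    have := hwL s (Finset.mem_filter.mp hs).1
    simp only [Finset.mem_image, Finset.mem_union] at hs'
    rcases hs' with (⟨u, hu, rfl⟩ | ⟨u, hu, rfl⟩) | ⟨u, hu, rfl⟩ <;> simp at this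

end Complex

/-! ### Counting the simplices that contain a given one -/

section Count

variable {V : Type*} [DecidableEq V] {R : Type*} [CommRing R]

/-- The sum of `x ^ (n - |u|) t ^ (|u| - |s|)` over the members `u` of `L` that contain `s`. -/
def starSum (L : Finset (Finset V)) (n : ℕ) (x t : R) (s : Finset V) : R :=
  ∑ u ∈ L with s ⊆ u, x ^ (n - u.card) * t ^ (u.card - s.card)

variable {K : PreAbstractSimplicialComplex V} {a b w : V} {L L' : Finset (Finset V)}

theorem starSum_eq_sum (L : Finset (Finset V)) (n : ℕ) (x t : R) (s : Finset V) :
    starSum L n x t s =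
      ∑ u ∈ L with ¬ ({a, b} : Finset V) ⊆ u,
        (if s ⊆ u then x ^ (n - u.card) * t ^ (u.card - s.card) else 0) +
      ∑ u ∈ L with {a, b} ⊆ u,
        (if s ⊆ u then x ^ (n - u.card) * t ^ (u.card - s.card) else 0) := by
  rw [starSum, Finset.sum_filter, add_comm, Finset.sum_filter_add_sum_filter_not]

theorem starSum_union (L : Finset (Finset V)) (n : ℕ) (x t : R) (s : Finset V) :
    starSum L n x t (s ∪ {a, b}) =
      ∑ u ∈ L with {a, b} ⊆ u,
        (if s ⊆ u then x ^ (n - u.card) * t ^ (u.card - (s ∪ {a, b}).card) else 0) := by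
  rw [starSum, Finset.sum_filter, Finset.sum_filter]
  refine Finset.sum_congr rfl fun u _ => ?_
  simp only [Finset.union_subset_iff]
  by_cases h1 : s ⊆ u <;> by_cases h2 : ({a, b} : Finset V) ⊆ u <;> simp [h1, h2]

/-- Replacing one end of the edge by `w` keeps the size of a simplex, and replacing both ends lowers
it by one; this accounts for the exponents. -/
theorem starSum_stellar (hab : a ≠ b)
    (hw : {w} ∉ K.faces) (hL : ∀ s, s ∈ L ↔ IsSimplex K s)
    (hL' : ∀ s, s ∈ L' ↔ IsSimplex (stellar K {a, b} w) s) (n : ℕ) (x t : R) (s : Finset V) :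
    starSum L' n x t s =
      ∑ u ∈ L with ¬ ({a, b} : Finset V) ⊆ u,
        (if s ⊆ u then x ^ (n - u.card) * t ^ (u.card - s.card) else 0) +
      ∑ u ∈ L with {a, b} ⊆ u,
        ((if s ⊆ insert w (u \ {a}) then x ^ (n - u.card) * t ^ (u.card - s.card) else 0) +
        (if s ⊆ insert w (u \ {b}) then x ^ (n - u.card) * t ^ (u.card - s.card) else 0) +
        (if s ⊆ insert w (u \ {a, b}) then
          x ^ (n - (u.card - 1)) * t ^ (u.card - 1 - s.card) else 0)) := by
  rw [starSum, Finset.sum_filter, sum_stellar hab hw hL hL']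
  congr 1
  refine Finset.sum_congr rfl fun u hu => ?_
  rw [Finset.mem_filter, hL] at hu
  have hwu := hu.1.notMem hw
  have hcard : ∀ c ⊆ u, (insert w (u \ c)).card = u.card - c.card + 1 := fun c hc => by
    rw [Finset.card_insert_of_notMem (fun h => hwu (Finset.mem_sdiff.mp h).1),
      Finset.card_sdiff_of_subset hc]
  have ha : a ∈ u := hu.2 (by simp)
  have hb : b ∈ u := hu.2 (by simp)
  have h2 : 2 ≤ u.card := by
    rw [← Finset.card_pair hab]
    exact Finset.card_le_card hu.2
  have h3 : u.card - 2 + 1 = u.card - 1 := by omega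
  have h4 : u.card - 1 + 1 = u.card := by omega
  rw [hcard _ (Finset.singleton_subset_iff.mpr ha), hcard _ (Finset.singleton_subset_iff.mpr hb),
    hcard _ hu.2, Finset.card_singleton, Finset.card_singleton, Finset.card_pair hab, h3, h4]

/-- The cut case. Each `u` containing `s` and the edge is replaced by three simplices containing
`s`: two of the same size and one smaller. At `x = α - t` the factor `(x + t) * t` is `αt`. -/
theorem starSum_stellar_of_disjoint (hab : a ≠ b)
    (hw : {w} ∉ K.faces) (hL : ∀ s, s ∈ L ↔ IsSimplex K s)
    (hL' : ∀ s, s ∈ L' ↔ IsSimplex (stellar K {a, b} w) s) {n : ℕ} (hn : ∀ u ∈ L, u.card ≤ n)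
    (x t : R) {s : Finset V} (hws : w ∉ s) (ha : a ∉ s) (hb : b ∉ s) :
    starSum L' n x t s = starSum L n x t s + (x + t) * t * starSum L n x t (s ∪ {a, b}) := by
  rw [starSum_stellar hab hw hL hL', starSum_union, starSum_eq_sum (a := a) (b := b), add_assoc,
    Finset.mul_sum, ← Finset.sum_add_distrib]
  congr 1
  refine Finset.sum_congr rfl fun u hu => ?_
  rw [Finset.mem_filter] at hu
  have hsub : ∀ c : Finset V, Disjoint s c → (s ⊆ insert w (u \ c) ↔ s ⊆ u) := by
    intro c hc
    rw [Finset.subset_insert_iff_of_notMem hws, Finset.subset_sdiff, and_iff_left hc]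
  simp only [hsub _ (Finset.disjoint_singleton_right.mpr ha),
    hsub _ (Finset.disjoint_singleton_right.mpr hb),
    hsub {a, b} (by simp [ha, hb])]
  by_cases hs : s ⊆ u
  · have hc : (s ∪ {a, b}).card = s.card + 2 := by
      rw [Finset.card_union_of_disjoint (by simp [ha, hb]), Finset.card_pair hab]
    have hle := Finset.card_le_card (Finset.union_subset hs hu.2)
    have hun := hn u hu.1
    rw [hc] at hle
    obtain ⟨k, hk⟩ := Nat.exists_eq_add_of_le hle
    obtain ⟨j, hj⟩ := Nat.exists_eq_add_of_le hun
    simp only [hc, if_pos hs]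
    rw [show n - u.card = j by omega, show u.card - s.card = k + 2 by omega,
      show n - (u.card - 1) = j + 1 by omega, show u.card - 1 - s.card = k + 1 by omega,
      show u.card - (s.card + 2) = k by omega]
    ring
  · simp [hs]

/-- Of the three simplices that replace `u`, only the one in which `b` gives way to `w` can still
contain `a`, so the count is unchanged. -/
theorem starSum_stellar_of_mem (hab : a ≠ b)
    (hw : {w} ∉ K.faces) (hL : ∀ s, s ∈ L ↔ IsSimplex K s)
    (hL' : ∀ s, s ∈ L' ↔ IsSimplex (stellar K {a, b} w) s) (n : ℕ)
    (x t : R) {s : Finset V} (hws : w ∉ s) (ha : a ∈ s) (hb : b ∉ s) :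
    starSum L' n x t s = starSum L n x t s := by
  rw [starSum_stellar hab hw hL hL', starSum_eq_sum (a := a) (b := b)]
  congr 1
  refine Finset.sum_congr rfl fun u hu => ?_
  simp only [Finset.subset_insert_iff_of_notMem hws, Finset.subset_sdiff,
    Finset.disjoint_singleton_right, Finset.disjoint_insert_right, ha, hb, not_true_eq_false,
    not_false_eq_true, and_false, and_true, if_false, zero_add, add_zero]

/-- The prism case: two simplices of the size of `u` and one smaller give `2 * t + x`, which is `α +
t` at `x = α - t`. They correspond to the two ends of the prism `Q × I` and to its interior. -/
theorem starSum_stellar_insert_of_disjoint (hab : a ≠ b)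
    (hw : {w} ∉ K.faces) (hL : ∀ s, s ∈ L ↔ IsSimplex K s)
    (hL' : ∀ s, s ∈ L' ↔ IsSimplex (stellar K {a, b} w) s) {n : ℕ} (hn : ∀ u ∈ L, u.card ≤ n)
    (x t : R) {s : Finset V} (hws : w ∉ s) (ha : a ∉ s) (hb : b ∉ s) :
    starSum L' n x t (insert w s) = (x + 2 * t) * starSum L n x t (s ∪ {a, b}) := by
  rw [starSum_stellar hab hw hL hL', starSum_union, Finset.sum_eq_zero, zero_add, Finset.mul_sum]
  · refine Finset.sum_congr rfl fun u hu => ?_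
    rw [Finset.mem_filter] at hu
    have hsub : ∀ c : Finset V, Disjoint s c → (insert w s ⊆ insert w (u \ c) ↔ s ⊆ u) := by
      intro c hc
      rw [Finset.insert_subset_insert_iff hws, Finset.subset_sdiff, and_iff_left hc]
    simp only [hsub _ (Finset.disjoint_singleton_right.mpr ha),
      hsub _ (Finset.disjoint_singleton_right.mpr hb),
      hsub {a, b} (by simp [ha, hb]), Finset.card_insert_of_notMem hws]
    by_cases hs : s ⊆ u
    · have hc : (s ∪ {a, b}).card = s.card + 2 := by
        rw [Finset.card_union_of_disjoint (by simp [ha, hb]), Finset.card_pair hab]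
      have hle := Finset.card_le_card (Finset.union_subset hs hu.2)
      have hun := hn u hu.1
      rw [hc] at hle
      obtain ⟨k, hk⟩ := Nat.exists_eq_add_of_le hle
      obtain ⟨j, hj⟩ := Nat.exists_eq_add_of_le hun
      simp only [hc, if_pos hs]
      rw [show n - u.card = j by omega, show u.card - (s.card + 1) = k + 1 by omega,
        show n - (u.card - 1) = j + 1 by omega, show u.card - 1 - (s.card + 1) = k by omega,
        show u.card - (s.card + 2) = k by omega]
      ring
    · simp [hs]
  · intro u hu
    rw [Finset.mem_filter] at hu
    exact if_neg fun h => ((hL u).mp hu.1).notMem hw (h (Finset.mem_insert_self _ _))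

/-- The case of an end of the prism `G × I`: again only the replacement of `b` by `w` survives, and
`insert w s` has as many vertices as `s ∪ {a, b}`. -/
theorem starSum_stellar_insert_of_mem (hab : a ≠ b)
    (hw : {w} ∉ K.faces) (hL : ∀ s, s ∈ L ↔ IsSimplex K s)
    (hL' : ∀ s, s ∈ L' ↔ IsSimplex (stellar K {a, b} w) s) (n : ℕ)
    (x t : R) {s : Finset V} (hws : w ∉ s) (ha : a ∈ s) (hb : b ∉ s) :
    starSum L' n x t (insert w s) = starSum L n x t (s ∪ {a, b}) := by
  have hc : (s ∪ {a, b}).card = (insert w s).card := by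
    rw [Finset.card_insert_of_notMem hws, Finset.union_insert, Finset.union_singleton,
      Finset.insert_comm, Finset.insert_eq_of_mem ha, Finset.card_insert_of_notMem hb]
  rw [starSum_stellar hab hw hL hL', starSum_union, hc, Finset.sum_eq_zero, zero_add]
  · refine Finset.sum_congr rfl fun u hu => ?_
    simp only [Finset.insert_subset_insert_iff hws, Finset.subset_sdiff,
      Finset.disjoint_singleton_right, Finset.disjoint_insert_right, ha, hb, not_true_eq_false,
      not_false_eq_true, and_false, and_true, if_false, zero_add, add_zero]
  · intro u hu
    rw [Finset.mem_filter] at hu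
    exact if_neg fun h => ((hL u).mp hu.1).notMem hw (h (Finset.mem_insert_self _ _))

end Count

/-! ### `γ`-polynomials -/

/-- The homogeneous polynomial of degree `d` with `γ`-polynomial `g`. -/
def gammaExpansion (d : ℕ) (g : Polynomial ℤ) : MvPolynomial (Fin 2) ℤ :=
  ∑ i ∈ Finset.range (d / 2 + 1),
    MvPolynomial.C (g.coeff i) * (MvPolynomial.X 0 * MvPolynomial.X 1) ^ i *
      (MvPolynomial.X 0 + MvPolynomial.X 1) ^ (d - 2 * i)

theorem gammaExpansion_one (d : ℕ) :
    gammaExpansion d 1 = (MvPolynomial.X 0 + MvPolynomial.X 1) ^ d := by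
  rw [gammaExpansion, Finset.sum_eq_single_of_mem 0 (by simp)]
  · simp
  · intro i _ hi
    simp [Polynomial.coeff_one, hi]

/-- For odd `d` the expansion in degree `d + 1` has one more term; the degree bound makes its
coefficient vanish. -/
theorem gammaExpansion_succ {d : ℕ} {g : Polynomial ℤ} (hg : g.natDegree ≤ d / 2) :
    gammaExpansion (d + 1) g = (MvPolynomial.X 0 + MvPolynomial.X 1) * gammaExpansion d g := by
  rw [gammaExpansion, gammaExpansion, Finset.mul_sum]
  have hsub : Finset.range (d / 2 + 1) ⊆ Finset.range ((d + 1) / 2 + 1) :=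
    Finset.range_subset_range.mpr (by omega)
  rw [← Finset.sum_subset hsub]
  · refine Finset.sum_congr rfl fun i hi => ?_
    rw [Finset.mem_range] at hi
    rw [show d + 1 - 2 * i = d - 2 * i + 1 by omega]
    ring
  · intro i _ hi
    rw [Finset.mem_range, not_lt] at hi
    rw [Polynomial.coeff_eq_zero_of_natDegree_lt (by omega)]
    simp

theorem gammaExpansion_add_X_mul (d : ℕ) (g h : Polynomial ℤ) :
    gammaExpansion (d + 2) (g + Polynomial.X * h) = gammaExpansion (d + 2) g +
      MvPolynomial.X 0 * MvPolynomial.X 1 * gammaExpansion d h := by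
  have hX : gammaExpansion (d + 2) (Polynomial.X * h) =
      MvPolynomial.X 0 * MvPolynomial.X 1 * gammaExpansion d h := by
    rw [gammaExpansion, gammaExpansion, Finset.mul_sum, show (d + 2) / 2 + 1 = d / 2 + 1 + 1 by omega,
      Finset.sum_range_succ', Polynomial.coeff_X_mul_zero]
    simp only [map_zero, zero_mul, add_zero]
    refine Finset.sum_congr rfl fun i _ => ?_
    rw [Polynomial.coeff_X_mul, show d + 2 - 2 * (i + 1) = d - 2 * i by omega]
    ring
  rw [← hX]
  simp only [gammaExpansion, ← Finset.sum_add_distrib, Polynomial.coeff_add, map_add, add_mul]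

/-! ### Clique complexes and cones -/

section Cone

variable {V : Type*}

/-- `K` is the complex of cliques of the graph `Γ` on the vertex set `W`. -/
def IsCliqueComplex (K : PreAbstractSimplicialComplex V) (Γ : V → V → Prop) (W : Set V) : Prop :=
  ∀ s, s ∈ K.faces ↔ s.Nonempty ∧ (∀ v ∈ s, v ∈ W) ∧ ∀ u ∈ s, ∀ v ∈ s, u ≠ v → Γ u v

theorem fPolynomial_bot : fPolynomial (⊥ : PreAbstractSimplicialComplex V) = 1 := by
  have : (⊥ : PreAbstractSimplicialComplex V).faces = ∅ := rfl
  rw [fPolynomial, this, finsum_mem_empty, add_zero]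

variable [DecidableEq V] {K L : PreAbstractSimplicialComplex V} {Γ : V → V → Prop} {W U : Set V}

theorem IsCliqueComplex.isFlag (h : IsCliqueComplex K Γ W) : IsFlag K := by
  intro s hne hv he
  refine (h s).mpr ⟨hne, fun v hvs => ?_, fun u hu v hvs huv => ?_⟩
  · exact ((h _).mp (hv v hvs)).2.1 v (Finset.mem_singleton_self v)
  · exact ((h _).mp (he u hu v hvs huv)).2.2 u (by simp) v (by simp) huv

theorem mem_sup_cone_iff {w : V} (hLK : L.faces ⊆ K.faces) {s : Finset V} :
    s ∈ (K ⊔ cone L w).faces ↔ s ∈ K.faces ∨ w ∈ s ∧ IsSimplex L (s.erase w) := by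
  change s ∈ K.faces ∨ (s ∈ L.faces ∨ _) ↔ _
  constructor
  · rintro (h | h | h)
    · exact Or.inl h
    · exact Or.inl (hLK h)
    · exact Or.inr h
  · rintro (h | h)
    · exact Or.inl h
    · exact Or.inr (Or.inr h)

/-- Extend the graph `Γ` by the vertex `w`, joined to the vertices in `W`. -/
def extendGraph (Γ : V → V → Prop) (w : V) (W : Set V) (u v : V) : Prop :=
  if u = w then v ∈ W else if v = w then u ∈ W else Γ u v

theorem IsCliqueComplex.extendGraph (hK : IsCliqueComplex K Γ W) {w : V} (hw : w ∉ W) (U : Set V) :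
    IsCliqueComplex K (extendGraph Γ w U) W := by
  intro s
  rw [hK s]
  refine and_congr_right fun _ => and_congr_right fun hs => ?_
  refine forall₂_congr fun u hu => forall₂_congr fun v hv => ?_
  have huw : u ≠ w := fun h => hw (by simpa only [h] using hs u hu)
  have hvw : v ≠ w := fun h => hw (by simpa only [h] using hs v hv)
  rw [TwoTruncatedCube.extendGraph, if_neg huw, if_neg hvw]

/-- The cliques through `w` are `w` together with a clique inside `W ∩ U`. The union with the cone
remains a clique complex precisely because `L` is all of the clique complex on `W ∩ U`. -/
theorem IsCliqueComplex.sup_cone (hK : IsCliqueComplex K Γ W) (hL : IsCliqueComplex L Γ (W ∩ U))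
    {w : V} (hw : w ∉ W) :
    IsCliqueComplex (K ⊔ cone L w) (TwoTruncatedCube.extendGraph Γ w U) (insert w W) := by
  have hLK : L.faces ⊆ K.faces := fun s hs =>
    (hK s).mpr ⟨((hL s).mp hs).1, fun v hv => (((hL s).mp hs).2.1 v hv).1, ((hL s).mp hs).2.2⟩
  intro s
  rw [mem_sup_cone_iff hLK, hK.extendGraph hw U s]
  by_cases hws : w ∈ s
  · have h1 : ¬ ∀ v ∈ s, v ∈ W := fun h => hw (h w hws)
    simp only [h1, false_and, and_false, false_or, hws, true_and]
    have hne : s.Nonempty := ⟨w, hws⟩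
    simp only [hne, true_and]
    constructor
    · intro h
      have hv : ∀ v ∈ s, v ≠ w → v ∈ W ∩ U := by
        intro v hv hvw
        have hmem : v ∈ s.erase w := Finset.mem_erase.mpr ⟨hvw, hv⟩
        exact ((hL _).mp (h.mem_faces ⟨v, hmem⟩)).2.1 v hmem
      refine ⟨fun v hvs => ?_, fun u hu v hvs huv => ?_⟩
      · by_cases hvw : v = w
        · exact Or.inl hvw
        · exact Or.inr (hv v hvs hvw).1
      · rw [TwoTruncatedCube.extendGraph]
        split_ifs with h2 h3
        · exact (hv v hvs (fun h => huv (h2.trans h.symm))).2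
        · exact (hv u hu h2).2
        · have hu' : u ∈ s.erase w := Finset.mem_erase.mpr ⟨h2, hu⟩
          exact ((hL _).mp (h.mem_faces ⟨u, hu'⟩)).2.2 u hu' v (Finset.mem_erase.mpr ⟨h3, hvs⟩) huv
    · rintro ⟨h2, h3⟩
      rcases (s.erase w).eq_empty_or_nonempty with he | he
      · exact Or.inl he
      refine Or.inr ((hL _).mpr ⟨he, fun v hv => ?_, fun u hu v hv huv => ?_⟩)
      · rw [Finset.mem_erase] at hv
        refine ⟨(h2 v hv.2).resolve_left hv.1, ?_⟩
        have := h3 w hws v hv.2 hv.1.symm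
        rwa [TwoTruncatedCube.extendGraph, if_pos rfl] at this
      · rw [Finset.mem_erase] at hu hv
        have := h3 u hu.2 v hv.2 huv
        rwa [TwoTruncatedCube.extendGraph, if_neg hu.1, if_neg hv.1] at this
  · simp only [hws, false_and, or_false]
    refine and_congr_right fun _ => and_congr_left fun _ => forall₂_congr fun v hv => ?_
    have hvw : v ≠ w := fun h => hws (by simpa only [h] using hv)
    rw [Set.mem_insert_iff, or_iff_right hvw]

/-- The new simplices are `insert w t` for `t` in `L` or empty, one vertex more than `t`; the empty
`t` supplies the constant term of `fPolynomial L`. -/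
theorem fPolynomial_sup_cone {w : V} (hLK : L.faces ⊆ K.faces) (hK : K.faces.Finite)
    (hw : ∀ s ∈ K.faces, w ∉ s) :
    fPolynomial (K ⊔ cone L w) = fPolynomial K + Polynomial.X * fPolynomial L := by
  have hset : (K ⊔ cone L w).faces = K.faces ∪ (insert w) '' (insert ∅ L.faces) := by
    ext s
    rw [mem_sup_cone_iff hLK, Set.mem_union, Set.mem_image]
    refine or_congr Iff.rfl ⟨fun h => ⟨s.erase w, h.2, Finset.insert_erase h.1⟩, ?_⟩
    rintro ⟨t, ht, rfl⟩
    have hwt : w ∉ t := by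
      rcases ht with rfl | ht
      · simp
      · exact hw t (hLK ht)
    rw [Finset.erase_insert hwt]
    exact ⟨Finset.mem_insert_self _ _, ht⟩
  have hwL : ∀ t ∈ insert ∅ L.faces, w ∉ t := by
    rintro t (rfl | ht)
    · simp
    · exact hw t (hLK ht)
  have hLfin : L.faces.Finite := hK.subset hLK
  have hempty : (∅ : Finset V) ∉ L.faces := fun h =>
    Finset.not_nonempty_empty (L.isRelLowerSet_faces h).1
  rw [fPolynomial, hset, finsum_mem_union ?_ hK ((hLfin.insert _).image _), finsum_mem_image ?_,
    finsum_mem_insert _ hempty hLfin]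
  · have : ∑ᶠ s ∈ L.faces, (Polynomial.X : Polynomial ℤ) ^ (insert w s).card =
        Polynomial.X * ∑ᶠ s ∈ L.faces, (Polynomial.X : Polynomial ℤ) ^ s.card := by
      rw [mul_finsum_mem]
      refine finsum_mem_congr rfl fun s hs => ?_
      rw [Finset.card_insert_of_notMem (hwL s (Or.inr hs)), pow_succ']
    rw [this, fPolynomial, fPolynomial]
    simp only [insert_empty_eq, Finset.card_singleton, pow_one]
    ring
  · intro s hs t ht h
    rw [← Finset.erase_insert (hwL s hs), ← Finset.erase_insert (hwL t ht), h]
  · rw [Set.disjoint_left]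
    rintro _ hs ⟨t, -, rfl⟩
    exact hw _ hs (Finset.mem_insert_self _ _)

end Cone

/-! ### The correspondence between faces and simplices of the dual complex -/

section Dual

variable {A : Set E} {K : PreAbstractSimplicialComplex ℕ} (e : DualIso A K)

/-- The simplex that corresponds to a face. -/
def simplexOf (Q : Face A) : Finset ℕ := (OrderDual.ofDual (e Q)).1

/-- The face that corresponds to a simplex. -/
def faceOf (s : Finset ℕ) (hs : IsSimplex K s) : Face A := e.symm (OrderDual.toDual ⟨s, hs⟩)

theorem isSimplex_simplexOf (Q : Face A) : IsSimplex K (simplexOf e Q) := (OrderDual.ofDual (e Q)).2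

theorem simplexOf_faceOf {s : Finset ℕ} (hs : IsSimplex K s) : simplexOf e (faceOf e s hs) = s := by
  simp [simplexOf, faceOf]

theorem simplexOf_subset_iff {Q R : Face A} : simplexOf e Q ⊆ simplexOf e R ↔ R ≤ Q := by
  rw [← e.le_iff_le]
  rfl

theorem simplexOf_injective : Function.Injective (simplexOf e) := fun _ _ h =>
  le_antisymm ((simplexOf_subset_iff e).mp h.ge) ((simplexOf_subset_iff e).mp h.le)

theorem isSimplex_iff {s : Finset ℕ} : IsSimplex K s ↔ ∃ Q, simplexOf e Q = s := by
  constructor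
  · exact fun hs => ⟨_, simplexOf_faceOf e hs⟩
  · rintro ⟨Q, rfl⟩
    exact isSimplex_simplexOf e Q

theorem isSimplex_union_iff {Q R : Face A} :
    IsSimplex K (simplexOf e Q ∪ simplexOf e R) ↔ ∃ B, B ≤ Q ∧ B ≤ R := by
  constructor
  · intro h
    refine ⟨faceOf e _ h, ?_, ?_⟩ <;> rw [← simplexOf_subset_iff e, simplexOf_faceOf]
    · exact Finset.subset_union_left
    · exact Finset.subset_union_right
  · rintro ⟨B, hQ, hR⟩
    exact (isSimplex_simplexOf e B).mono (Finset.union_subset ((simplexOf_subset_iff e).mpr hQ)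
      ((simplexOf_subset_iff e).mpr hR))

theorem Face.inter_nonempty_iff {Q R : Face A} :
    (Q.1 ∩ R.1).Nonempty ↔ ∃ B, B ≤ Q ∧ B ≤ R :=
  ⟨fun h => ⟨Q.inter R h, Set.inter_subset_left, Set.inter_subset_right⟩,
    fun ⟨B, hQ, hR⟩ => B.2.1.mono (Set.subset_inter hQ hR)⟩

theorem Face.isGLB_inter (Q R : Face A) (h : (Q.1 ∩ R.1).Nonempty) :
    IsGLB {Q, R} (Q.inter R h) := by
  constructor
  · rintro B (rfl | rfl)
    · exact Set.inter_subset_left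
    · exact Set.inter_subset_right
  · intro B hB
    exact Set.subset_inter (hB (by simp) : B ≤ Q) (hB (by simp) : B ≤ R)

/-- Intersections of faces are handled as infima, so that they can be computed as unions of
simplices in any dual complex. -/
theorem isGLB_iff_simplexOf {Q R B : Face A} :
    IsGLB {Q, R} B ↔ simplexOf e B = simplexOf e Q ∪ simplexOf e R := by
  constructor
  · intro h
    have hQ : B ≤ Q := h.1 (by simp)
    have hR : B ≤ R := h.1 (by simp)
    have hs : IsSimplex K (simplexOf e Q ∪ simplexOf e R) :=
      (isSimplex_union_iff e).mpr ⟨B, hQ, hR⟩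
    apply subset_antisymm
    · rw [← simplexOf_faceOf e hs, simplexOf_subset_iff]
      apply h.2
      rintro C (rfl | rfl) <;> rw [← simplexOf_subset_iff e, simplexOf_faceOf]
      · exact Finset.subset_union_left
      · exact Finset.subset_union_right
    · exact Finset.union_subset ((simplexOf_subset_iff e).mpr hQ) ((simplexOf_subset_iff e).mpr hR)
  · intro h
    constructor
    · rintro C (rfl | rfl) <;> rw [← simplexOf_subset_iff e, h]
      · exact Finset.subset_union_left
      · exact Finset.subset_union_right
    · intro C hC
      rw [← simplexOf_subset_iff e, h]
      exact Finset.union_subset ((simplexOf_subset_iff e).mpr (hC (by simp)))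
        ((simplexOf_subset_iff e).mpr (hC (by simp)))

/-- In a Helly poset three elements with pairwise lower bounds have a common lower bound. -/
def IsHelly (α : Type*) [LE α] : Prop :=
  ∀ a b c : α, (∃ d, d ≤ a ∧ d ≤ b) → (∃ d, d ≤ b ∧ d ≤ c) → (∃ d, d ≤ a ∧ d ≤ c) →
    ∃ d, d ≤ a ∧ d ≤ b ∧ d ≤ c

theorem IsHelly.of_orderIso {α β : Type*} [LE α] [LE β] (f : α ≃o β) (h : IsHelly β) :
    IsHelly α := by
  have key : ∀ a b : α, (∃ d, d ≤ a ∧ d ≤ b) → ∃ d, d ≤ f a ∧ d ≤ f b := fun a b ⟨d, ha, hb⟩ =>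
    ⟨f d, f.le_iff_le.mpr ha, f.le_iff_le.mpr hb⟩
  intro a b c hab hbc hac
  obtain ⟨d, ha, hb, hc⟩ := h (f a) (f b) (f c) (key _ _ hab) (key _ _ hbc) (key _ _ hac)
  exact ⟨f.symm d, f.symm_apply_le.mpr ha, f.symm_apply_le.mpr hb, f.symm_apply_le.mpr hc⟩

/-- Faces have a common lower bound exactly when the union of their simplices is a simplex. The
Helly property expresses flagness through the face poset alone; this matters because each truncation
brings its own labelled complex `K`. -/
theorem isHelly_face_iff (e : DualIso A K) : IsHelly (Face A) ↔ IsFlag K := by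
  constructor
  · intro h
    refine isFlag_of_isSimplex_union fun p q r hpq hqr hpr => ?_
    obtain ⟨P, rfl⟩ := (isSimplex_iff e).mp (hpq.mono Finset.subset_union_left)
    obtain ⟨Q, rfl⟩ := (isSimplex_iff e).mp (hqr.mono Finset.subset_union_left)
    obtain ⟨R, rfl⟩ := (isSimplex_iff e).mp (hpr.mono Finset.subset_union_right)
    rw [isSimplex_union_iff] at hpq hqr hpr
    obtain ⟨D, hP, hQ, hR⟩ := h P Q R hpq hqr hpr
    exact (isSimplex_simplexOf e D).mono (Finset.union_subset (Finset.union_subset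
      ((simplexOf_subset_iff e).mpr hP) ((simplexOf_subset_iff e).mpr hQ))
      ((simplexOf_subset_iff e).mpr hR))
  · intro h P Q R hPQ hQR hPR
    rw [← isSimplex_union_iff e] at hPQ hQR hPR
    have hs := h.isSimplex_union hPQ hQR hPR
    refine ⟨faceOf e _ hs, ?_, ?_, ?_⟩ <;> rw [← simplexOf_subset_iff e, simplexOf_faceOf]
    · exact Finset.subset_union_left.trans Finset.subset_union_left
    · exact Finset.subset_union_right.trans Finset.subset_union_left
    · exact Finset.subset_union_right

end Dual

/-- The polytope as a face of itself. -/
def ConvexPolytope.topFace {n : ℕ} (P : ConvexPolytope E n) : Face P.carrier :=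
  ⟨P.carrier, by
    obtain ⟨S, hS, h⟩ := P.isHull
    rw [h]
    exact (Finset.coe_nonempty.mpr hS).convexHull, IsExposed.refl P.carrier⟩

theorem ConvexPolytope.le_topFace {n : ℕ} (P : ConvexPolytope E n) (Q : Face P.carrier) : Q ≤ P.topFace :=
  Q.2.2.subset

/-! ### Dimensions and the polynomial `H` in terms of simplices -/

section Dimension

variable [FiniteDimensional ℝ E] {n : ℕ} {P : ConvexPolytope E n}
  {K : PreAbstractSimplicialComplex ℕ}

/-- Adding a vertex to a simplex is a covering relation in the face poset, so by gradedness the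
dimension drops by exactly one, starting from `n` at the empty simplex. -/
theorem dim_faceOf_add_card (e : DualIso P.carrier K) (s : Finset ℕ) :
    ∀ hs : IsSimplex K s, dim (faceOf e s hs).1 + s.card = n := by
  induction s using Finset.induction_on with
  | empty =>
    intro hs
    have : faceOf e ∅ hs = P.topFace := by
      refine le_antisymm (P.le_topFace _) ?_
      rw [← simplexOf_subset_iff e, simplexOf_faceOf]
      exact Finset.empty_subset _
    rw [this, Finset.card_empty, add_zero]
    exact P.dim_eq
  | insert a s ha ih =>
    intro hs
    have hs' : IsSimplex K s := hs.mono (Finset.subset_insert a s)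
    have hlt : ∀ {Q R : Face P.carrier}, Q < R ↔ simplexOf e R ⊂ simplexOf e Q := by
      intro Q R
      rw [lt_iff_le_not_ge, ssubset_iff_subset_not_subset, simplexOf_subset_iff,
        simplexOf_subset_iff]
    have hcov : faceOf e (insert a s) hs ⋖ faceOf e s hs' := by
      refine ⟨?_, fun C h1 h2 => ?_⟩
      · rw [hlt, simplexOf_faceOf, simplexOf_faceOf]
        exact Finset.ssubset_insert ha
      · rw [hlt, simplexOf_faceOf] at h1 h2
        have h3 := Finset.card_lt_card h1
        have h4 := Finset.card_lt_card h2
        rw [Finset.card_insert_of_notMem ha] at h3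
        omega
    have h1 := P.isPolytope.dim_covBy hcov
    have h2 := ih hs'
    rw [Finset.card_insert_of_notMem ha]
    omega

theorem dim_add_card (e : DualIso P.carrier K) (Q : Face P.carrier) :
    dim Q.1 + (simplexOf e Q).card = n := by
  have h := dim_faceOf_add_card e (simplexOf e Q) (isSimplex_simplexOf e Q)
  rwa [simplexOf_injective e (simplexOf_faceOf e (isSimplex_simplexOf e Q))] at h

theorem exists_finset_isSimplex (e : DualIso P.carrier K) :
    ∃ L : Finset (Finset ℕ), (∀ s, s ∈ L ↔ IsSimplex K s) ∧ (∀ s ∈ L, s.card ≤ n) ∧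
      ∀ Q : Face P.carrier, HPolynomial Q.1 =
        starSum L n (MvPolynomial.X 0 - MvPolynomial.X 1) (MvPolynomial.X 1) (simplexOf e Q) := by
  classical
  have : Finite (Face P.carrier) := P.isPolytope.finite_face
  have := Fintype.ofFinite (Face P.carrier)
  refine ⟨Finset.univ.image (simplexOf e), fun s => ?_, fun s hs => ?_, fun Q => ?_⟩
  · simp [isSimplex_iff e]
  · obtain ⟨Q, -, rfl⟩ := Finset.mem_image.mp hs
    have := dim_add_card e Q
    omega
  · rw [P.isPolytope.HPolynomial_eq, starSum, Finset.filter_image,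
      Finset.sum_image (simplexOf_injective e).injOn]
    simp only [simplexOf_subset_iff]
    refine Finset.sum_congr rfl fun B _ => ?_
    have h1 := dim_add_card e B
    have h2 := dim_add_card e Q
    rw [show n - (simplexOf e B).card = dim B.1 by omega,
      show (simplexOf e B).card - (simplexOf e Q).card = dim Q.1 - dim B.1 by omega]

end Dimension

/-! ### The faces of the cube -/

section Cube

variable {n : ℕ}

/-- The endpoint of the unit interval that corresponds to a Boolean value. -/
def endpoint (b : Bool) : ℝ := if b then 1 else 0

/-- The points of the cube some of whose coordinates are prescribed endpoints. -/
def cubeFaceSet (s : Fin n → Option Bool) : Set (EuclideanSpace ℝ (Fin n)) :=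
  {x | x ∈ unitCube n ∧ ∀ i b, s i = some b → x i = endpoint b}

/-- The endpoint at which a linear function of slope `c` on the unit interval is maximal. -/
def maxEndpoint (c : ℝ) : Option Bool :=
  if 0 < c then some true else if c < 0 then some false else none

theorem endpoint_mem (b : Bool) : endpoint b ∈ Set.Icc (0 : ℝ) 1 := by
  cases b <;> simp [endpoint]

theorem mul_le_endpoint_mul {c : ℝ} {b : Bool} (hb : maxEndpoint c = some b) {y : ℝ}
    (hy : y ∈ Set.Icc (0 : ℝ) 1) : y * c ≤ endpoint b * c := by
  unfold maxEndpoint at hb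
  split_ifs at hb with h1 h2 <;> obtain rfl := Option.some.inj hb
  · exact mul_le_mul_of_nonneg_right hy.2 h1.le
  · have := mul_nonpos_of_nonneg_of_nonpos hy.1 h2.le
    simpa [endpoint] using this

theorem eq_zero_of_maxEndpoint {c : ℝ} (h : maxEndpoint c = none) : c = 0 := by
  unfold maxEndpoint at h
  split_ifs at h with h1 h2
  exact le_antisymm (not_lt.mp h1) (not_lt.mp h2)

theorem ne_zero_of_maxEndpoint {c : ℝ} {b : Bool} (h : maxEndpoint c = some b) : c ≠ 0 := by
  rintro rfl
  simp [maxEndpoint] at h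

theorem apply_eq_sum (l : StrongDual ℝ (EuclideanSpace ℝ (Fin n))) (x : EuclideanSpace ℝ (Fin n)) :
    l x = ∑ i, x i * l (EuclideanSpace.single i 1) := by
  have hx : x = ∑ i, x i • EuclideanSpace.single i (1 : ℝ) := by
    ext j
    simp [Finset.sum_apply, Pi.single_apply]
  conv_lhs => rw [hx]
  simp

/-- A linear functional is maximised on the cube one coordinate at a time, and the sign of each
slope decides the endpoint; slope zero leaves the coordinate free. -/
theorem toExposed_unitCube (l : StrongDual ℝ (EuclideanSpace ℝ (Fin n))) :
    l.toExposed (unitCube n) =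
      cubeFaceSet (fun i => maxEndpoint (l (EuclideanSpace.single i 1))) := by
  ext x
  constructor
  · rintro ⟨hx, hmax⟩
    refine ⟨hx, fun i b hb => ?_⟩
    set y : EuclideanSpace ℝ (Fin n) := x + (endpoint b - x i) • EuclideanSpace.single i 1 with hy
    have hyj : ∀ j, y j = if j = i then endpoint b else x j := by
      intro j
      by_cases hji : j = i
      · subst hji
        simp [hy]
      · simp [hy, hji]
    have hyc : y ∈ unitCube n := by
      intro j
      rw [hyj]
      split_ifs
      · exact endpoint_mem b
      · exact hx j
    have h1 := hmax y hyc
    have h2 := mul_le_endpoint_mul hb (hx i)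
    rw [hy, map_add, map_smul, smul_eq_mul] at h1
    exact mul_right_cancel₀ (ne_zero_of_maxEndpoint hb) (by linarith)
  · rintro ⟨hx, hs⟩
    refine ⟨hx, fun y hy => ?_⟩
    rw [apply_eq_sum, apply_eq_sum l x]
    refine Finset.sum_le_sum fun i _ => ?_
    rcases hb : maxEndpoint (l (EuclideanSpace.single i 1)) with _ | b
    · rw [eq_zero_of_maxEndpoint hb, mul_zero, mul_zero]
    · rw [hs i b hb]
      exact mul_le_endpoint_mul hb (hy i)

/-- A slope for which `maxEndpoint` has a prescribed value. -/
def slope : Option Bool → ℝ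
  | none => 0
  | some true => 1
  | some false => -1

theorem maxEndpoint_slope (o : Option Bool) : maxEndpoint (slope o) = o := by
  rcases o with _ | _ | _ <;> norm_num [maxEndpoint, slope]

theorem exists_toExposed_eq (s : Fin n → Option Bool) :
    ∃ l : StrongDual ℝ (EuclideanSpace ℝ (Fin n)), l.toExposed (unitCube n) = cubeFaceSet s := by
  refine ⟨innerSL ℝ (WithLp.toLp 2 fun i => slope (s i)), ?_⟩
  rw [toExposed_unitCube]
  congr
  funext i
  rw [innerSL_apply_apply, EuclideanSpace.inner_single_right]
  simp [maxEndpoint_slope]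

/-- A relatively interior point of a face of the cube. -/
def cubeFaceCenter (s : Fin n → Option Bool) : EuclideanSpace ℝ (Fin n) :=
  WithLp.toLp 2 fun i => (s i).elim (1 / 2) endpoint

theorem cubeFaceCenter_mem (s : Fin n → Option Bool) : cubeFaceCenter s ∈ cubeFaceSet s := by
  refine ⟨fun i => ?_, fun i b hb => by simp [cubeFaceCenter, hb]⟩
  rcases hb : s i with _ | b
  · norm_num [cubeFaceCenter, hb]
  · simpa [cubeFaceCenter, hb] using endpoint_mem b

/-- The face of the cube given by prescribed endpoints. -/
def cubeFace (s : Fin n → Option Bool) : Face (unitCube n) :=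
  ⟨cubeFaceSet s, ⟨_, cubeFaceCenter_mem s⟩, by
    obtain ⟨l, hl⟩ := exists_toExposed_eq s
    rw [← hl]
    exact ContinuousLinearMap.toExposed.isExposed⟩

theorem cubeFace_surjective : Function.Surjective (cubeFace (n := n)) := by
  rintro ⟨B, hne, hB⟩
  obtain ⟨l, hl⟩ := hB hne
  refine ⟨fun i => maxEndpoint (l (EuclideanSpace.single i 1)), Subtype.ext ?_⟩
  exact ((toExposed_unitCube l).symm.trans hl.symm)

theorem cubeFace_le_iff {s u : Fin n → Option Bool} :
    cubeFace u ≤ cubeFace s ↔ ∀ i b, s i = some b → u i = some b := by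
  constructor
  · intro h i b hb
    -- The centre has the value `1 / 2` at free coordinates, so it reveals which coordinates are
    -- prescribed.
    have h1 : cubeFaceCenter u i = endpoint b := (h (cubeFaceCenter_mem u)).2 i b hb
    rcases hc : u i with _ | c
    · exfalso
      rw [cubeFaceCenter, PiLp.toLp_apply, hc] at h1
      cases b <;> norm_num [endpoint] at h1
    · rw [cubeFaceCenter, PiLp.toLp_apply, hc] at h1
      revert h1
      cases b <;> cases c <;> simp [endpoint]
  · exact fun h x hx => ⟨hx.1, fun i b hb => hx.2 i b (h i b hb)⟩

theorem cubeFace_injective : Function.Injective (cubeFace (n := n)) := by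
  intro s u h
  funext i
  have h1 := cubeFace_le_iff.mp h.le
  have h2 := cubeFace_le_iff.mp h.ge
  rcases hs : s i with _ | b
  · rcases hu : u i with _ | b
    · rfl
    · rw [h1 i b hu] at hs
      exact absurd hs (by simp)
  · exact (h2 i b hs).symm

/-- Faces are partial assignments of endpoints, and two of them meet when the assignments agree
where both are defined. Pairwise compatible assignments have a common extension. -/
theorem isHelly_unitCube : IsHelly (Face (unitCube n)) := by
  intro A B C hAB hBC hAC
  obtain ⟨a, rfl⟩ := cubeFace_surjective A
  obtain ⟨b, rfl⟩ := cubeFace_surjective B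
  obtain ⟨c, rfl⟩ := cubeFace_surjective C
  have key : ∀ p q : Fin n → Option Bool, (∃ D, D ≤ cubeFace p ∧ D ≤ cubeFace q) →
      ∀ i x y, p i = some x → q i = some y → x = y := by
    rintro p q ⟨D, hp, hq⟩ i x y hx hy
    obtain ⟨d, rfl⟩ := cubeFace_surjective D
    exact Option.some.inj ((cubeFace_le_iff.mp hp i x hx).symm.trans (cubeFace_le_iff.mp hq i y hy))
  refine ⟨cubeFace fun i => (a i).or ((b i).or (c i)), ?_, ?_, ?_⟩ <;> rw [cubeFace_le_iff] <;>
    intro i x hx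
  · simp [hx]
  · rcases ha : a i with _ | y
    · simp [hx]
    · simp [key a b hAB i y x ha hx]
  · rcases ha : a i with _ | y
    · rcases hb : b i with _ | y
      · simp [hx]
      · simp [key b c hBC i y x hb hx]
    · simp [key a c hAC i y x ha hx]

/-- The number of free coordinates. -/
def freeCard (s : Fin n → Option Bool) : ℕ := (Finset.univ.filter fun i => s i = none).card

/-- The sum factors over coordinates: a free coordinate of `s` may stay free (`x`) or be fixed in
two ways (`2 * t`), and a prescribed one contributes `1`. -/
theorem sum_cubeFace {R : Type*} [CommRing R] (x t : R) (s : Fin n → Option Bool)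
    [DecidablePred fun u => cubeFace u ≤ cubeFace s] :
    ∑ u : Fin n → Option Bool with cubeFace u ≤ cubeFace s,
      x ^ freeCard u * t ^ (freeCard s - freeCard u) = (x + 2 * t) ^ freeCard s := by
  set T : Fin n → Finset (Option Bool) := fun i =>
    if s i = none then Finset.univ else {s i} with hT
  have hset : (Finset.univ.filter fun u : Fin n → Option Bool => cubeFace u ≤ cubeFace s) =
      Fintype.piFinset T := by
    ext u
    rw [Finset.mem_filter, Fintype.mem_piFinset, cubeFace_le_iff]
    simp only [Finset.mem_univ, true_and]
    refine forall_congr' fun i => ?_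
    rcases hs : s i with _ | b <;> simp [hT, hs]
  have hterm : ∀ u ∈ Fintype.piFinset T, x ^ freeCard u * t ^ (freeCard s - freeCard u) =
      ∏ i, ((if u i = none then x else 1) * (if s i = none ∧ ¬ u i = none then t else 1)) := by
    intro u hu
    rw [← hset, Finset.mem_filter, cubeFace_le_iff] at hu
    have hsub : (Finset.univ.filter fun i => u i = none) ⊆
        (Finset.univ.filter fun i => s i = none) := by
      intro i hi
      rw [Finset.mem_filter] at hi ⊢
      refine ⟨hi.1, ?_⟩
      rcases hs : s i with _ | b
      · rfl
      · rw [hu.2 i b hs] at hi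
        simp at hi
    have hcard : freeCard s - freeCard u =
        (Finset.univ.filter fun i => s i = none ∧ ¬ u i = none).card := by
      rw [freeCard, freeCard, ← Finset.card_sdiff_of_subset hsub]
      congr 1
      ext i
      simp
    rw [Finset.prod_mul_distrib, hcard, freeCard]
    simp only [Finset.prod_ite, Finset.prod_const, one_pow, mul_one]
  rw [hset, Finset.sum_congr rfl hterm, ← Finset.prod_univ_sum T
    (fun i o => (if o = none then x else 1) * (if s i = none ∧ ¬ o = none then t else 1))]
  have hfac : ∀ i, ∑ o ∈ T i, (if o = none then x else 1) *
      (if s i = none ∧ ¬ o = none then t else 1) = if s i = none then x + 2 * t else 1 := by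
    intro i
    rcases hs : s i with _ | b
    · simp [hT, hs, Fintype.sum_option]
    · simp [hT, hs]
  rw [Finset.prod_congr rfl fun i _ => hfac i, Finset.prod_ite, Finset.prod_const_one, mul_one,
    Finset.prod_const, freeCard]

end Cube

/-! ### Polytopes combinatorially equivalent to a cube -/

section CombinatorialCube

variable [FiniteDimensional ℝ E] {n : ℕ} {P : ConvexPolytope E n}
  (e : Face P.carrier ≃o Face (unitCube n))

theorem cubeFace_lt_update {s : Fin n → Option Bool} {i : Fin n} {b : Bool} (hi : s i = some b) :
    cubeFace s < cubeFace (Function.update s i none) := by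
  refine lt_of_le_of_ne (cubeFace_le_iff.mpr fun j c hj => ?_) fun h => ?_
  · by_cases hji : j = i
    · subst hji
      simp at hj
    · rwa [Function.update_of_ne hji] at hj
  · have := congrFun (cubeFace_injective h) i
    rw [hi, Function.update_self] at this
    simp at this

theorem freeCard_update {s : Fin n → Option Bool} {i : Fin n} {b : Bool} (hi : s i = some b) :
    freeCard (Function.update s i none) = freeCard s + 1 := by
  have : (Finset.univ.filter fun j => Function.update s i none j = none) =
      insert i (Finset.univ.filter fun j => s j = none) := by
    ext j
    by_cases hji : j = i
    · subst hji
      simp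
    · simp [hji]
  rw [freeCard, freeCard, this, Finset.card_insert_of_notMem (by simp [hi])]

theorem freeCard_le (s : Fin n → Option Bool) : freeCard s ≤ n :=
  (Finset.card_le_univ _).trans_eq (Fintype.card_fin n)

/-- The polytope is a cube only combinatorially, so dimensions are squeezed: they increase strictly
along chains, and every face lies on a chain of `n + 1` faces from a vertex to the polytope of
dimension `n`. Descending from the top gives this bound; `le_dim_cubeFace` ascends from the
vertices. -/
theorem dim_cubeFace_le (k : ℕ) : ∀ s : Fin n → Option Bool, n - freeCard s = k →
    dim (e.symm (cubeFace s)).1 ≤ freeCard s := by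
  induction k with
  | zero =>
    intro s hs
    have h1 := freeCard_le s
    have h2 := Face.dim_mono (P.le_topFace (e.symm (cubeFace s)))
    have h3 : dim P.topFace.1 = n := P.dim_eq
    omega
  | succ k ih =>
    intro s hs
    obtain ⟨i, b, hi⟩ : ∃ i b, s i = some b := by
      by_contra hcon
      have hall : ∀ i, s i = none := fun i =>
        Option.eq_none_iff_forall_ne_some.mpr fun b hb => hcon ⟨i, b, hb⟩
      have : freeCard s = n := by simp [freeCard, hall]
      omega
    have h1 := freeCard_update hi
    have h2 := ih (Function.update s i none) (by omega)
    have h3 := Face.dim_strictMono (e.symm.lt_iff_lt.mpr (cubeFace_lt_update hi))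
    omega

theorem le_dim_cubeFace (k : ℕ) : ∀ s : Fin n → Option Bool, freeCard s = k →
    k ≤ dim (e.symm (cubeFace s)).1 := by
  induction k with
  | zero => exact fun _ _ => Nat.zero_le _
  | succ k ih =>
    intro s hs
    obtain ⟨i, hi⟩ : (Finset.univ.filter fun i => s i = none).Nonempty := by
      rw [← Finset.card_pos]
      exact (Nat.succ_pos k).trans_eq hs.symm
    rw [Finset.mem_filter] at hi
    have hu : Function.update s i (some true) i = some true := Function.update_self _ _ _
    have hs' : Function.update (Function.update s i (some true)) i none = s := by
      rw [Function.update_idem, ← hi.2, Function.update_eq_self]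
    have h1 := freeCard_update hu
    have h2 := cubeFace_lt_update hu
    rw [hs'] at h1 h2
    have h3 := Face.dim_strictMono (e.symm.lt_iff_lt.mpr h2)
    have h4 := ih (Function.update s i (some true)) (by omega)
    omega

theorem dim_cubeFace (s : Fin n → Option Bool) : dim (e.symm (cubeFace s)).1 = freeCard s :=
  le_antisymm (dim_cubeFace_le e _ s rfl) (le_dim_cubeFace e _ s rfl)

/-- With `x = α - t` the sum over the faces of `Q` is `(x + 2t) ^ d = (α + t) ^ d`, the expansion of
`γ = 1`. -/
theorem isGammaPolynomial_of_cube (e : Face P.carrier ≃o Face (unitCube n)) (Q : Face P.carrier) : IsGammaPolynomial Q.1 1 := by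
  classical
  refine ⟨by simp, ?_⟩
  change HPolynomial Q.1 = gammaExpansion (dim Q.1) 1
  have : Finite (Face P.carrier) := P.isPolytope.finite_face
  have := Fintype.ofFinite (Face P.carrier)
  obtain ⟨s, hs⟩ := cubeFace_surjective (e Q)
  obtain rfl : e.symm (cubeFace s) = Q := by rw [hs, e.symm_apply_apply]
  have hbij : Function.Bijective fun u : Fin n → Option Bool => e.symm (cubeFace u) :=
    e.symm.bijective.comp ⟨cubeFace_injective, cubeFace_surjective⟩
  rw [P.isPolytope.HPolynomial_eq, gammaExpansion_one, Finset.sum_filter,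
    ← hbij.sum_comp]
  simp only [dim_cubeFace, e.symm.le_iff_le]
  rw [← Finset.sum_filter, sum_cubeFace]
  congr 1
  ring

end CombinatorialCube

/-! ### The effect of a truncation -/

theorem IsGammaPolynomial.congr {A B : Set E} {g : Polynomial ℤ} (h : IsGammaPolynomial A g)
    (hd : dim B = dim A) (hH : HPolynomial B = HPolynomial A) : IsGammaPolynomial B g := by
  unfold IsGammaPolynomial at h ⊢
  rwa [hd, hH]

theorem IsGammaPolynomial.prism {A B : Set E} {g : Polynomial ℤ} (h : IsGammaPolynomial A g)
    (hd : dim B = dim A + 1)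
    (hH : HPolynomial B = (MvPolynomial.X 0 + MvPolynomial.X 1) * HPolynomial A) :
    IsGammaPolynomial B g := by
  obtain ⟨h1, h2⟩ := h
  refine ⟨by omega, ?_⟩
  change HPolynomial B = gammaExpansion (dim B) g
  rw [hd, gammaExpansion_succ h1, hH, h2]
  rfl

theorem IsGammaPolynomial.truncate {A B C : Set E} {g h : Polynomial ℤ}
    (hA : IsGammaPolynomial A g) (hC : IsGammaPolynomial C h) (hB : dim B = dim A)
    (hd : dim A = dim C + 2)
    (hH : HPolynomial B = HPolynomial A + MvPolynomial.X 0 * MvPolynomial.X 1 * HPolynomial C) :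
    IsGammaPolynomial B (g + Polynomial.X * h) := by
  obtain ⟨hA1, hA2⟩ := hA
  obtain ⟨hC1, hC2⟩ := hC
  constructor
  · refine (Polynomial.natDegree_add_le _ _).trans (max_le (by omega) ?_)
    refine Polynomial.natDegree_mul_le.trans ?_
    rw [Polynomial.natDegree_X]
    omega
  · change HPolynomial B = gammaExpansion (dim B) _
    change _ = gammaExpansion _ _ at hA2
    change _ = gammaExpansion _ _ at hC2
    rw [hH, hA2, hC2, hB, hd, gammaExpansion_add_X_mul]

namespace Truncation

variable {n : ℕ} {P P' : ConvexPolytope E n} (T : Truncation P P')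

theorem simplexOf_oldFace (Q' : Face P'.carrier) : simplexOf T.e (T.oldFace Q') =
    if T.w ∈ simplexOf T.e' Q' then (simplexOf T.e' Q').erase T.w ∪ T.σ else simplexOf T.e' Q' := by
  rw [oldFace]
  by_cases h : T.w ∈ T.simplex' Q'
  · rw [dif_pos h]
    exact (simplexOf_faceOf T.e (T.simplex'_of_mem Q' h)).trans (if_pos h).symm
  · rw [dif_neg h]
    exact (simplexOf_faceOf T.e (T.simplex'_of_notMem Q' h)).trans (if_neg h).symm

/-- The face `Q'` arises from a face which the truncation cuts along a face of codimension 2. -/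
def Cuts (Q' : Face P'.carrier) : Prop :=
  Disjoint (simplexOf T.e (T.oldFace Q')) T.σ ∧ IsSimplex T.K (simplexOf T.e (T.oldFace Q') ∪ T.σ)

theorem isSimplex_σ : IsSimplex T.K T.σ := isSimplex_simplexOf T.e T.G

/-- Passing to the old face is, on simplices, the substitution of `σ` for the vertex `w`, and this
commutes with unions. -/
theorem isGLB_oldFace {A B C : Face P'.carrier} (h : IsGLB {A, B} C) :
    IsGLB {T.oldFace A, T.oldFace B} (T.oldFace C) := by
  rw [isGLB_iff_simplexOf T.e'] at h
  rw [isGLB_iff_simplexOf T.e, simplexOf_oldFace, simplexOf_oldFace, simplexOf_oldFace, h]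
  generalize simplexOf T.e' A = p
  generalize simplexOf T.e' B = q
  by_cases hp : T.w ∈ p <;> by_cases hq : T.w ∈ q <;>
    simp only [Finset.mem_union, hp, hq, or_self, or_true, true_or, if_true, if_false,
      Finset.erase_union_distrib]
  · rw [Finset.union_union_union_comm, Finset.union_self]
  · rw [Finset.erase_eq_of_notMem hq, Finset.union_right_comm]
  · rw [Finset.erase_eq_of_notMem hp, Finset.union_assoc]

theorem isGLB_G_iff {Q R : Face P.carrier} :
    IsGLB {Q, T.G} R ↔ simplexOf T.e R = simplexOf T.e Q ∪ T.σ :=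
  isGLB_iff_simplexOf T.e

theorem isGLB_inter_oldFace (Q' : Face P'.carrier)
    (hne : (T.G.1 ∩ (T.oldFace Q').1).Nonempty) :
    IsGLB {T.oldFace Q', T.G} (T.G.inter (T.oldFace Q') hne) := by
  rw [Set.pair_comm]
  exact Face.isGLB_inter _ _ hne

/-- Disjointness from `σ` is clearly compatible with unions. That `A`, `B` and `G` have a common
face as soon as they meet pairwise is the Helly property of `P`; this is where it enters the
construction. -/
theorem cuts_iff_of_isGLB (hP : IsHelly (Face P.carrier)) {A B C : Face P'.carrier}
    (h : IsGLB {A, B} C) : T.Cuts C ↔ T.Cuts A ∧ T.Cuts B := by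
  have hflag := (isHelly_face_iff T.e).mp hP
  have hold := (isGLB_iff_simplexOf T.e).mp (T.isGLB_oldFace h)
  have hC := isSimplex_simplexOf T.e (T.oldFace C)
  unfold Cuts
  rw [hold] at hC ⊢
  rw [Finset.disjoint_union_left]
  constructor
  · rintro ⟨⟨h1, h2⟩, h3⟩
    exact ⟨⟨h1, h3.mono (Finset.union_subset_union_left Finset.subset_union_left)⟩,
      ⟨h2, h3.mono (Finset.union_subset_union_left Finset.subset_union_right)⟩⟩
  · rintro ⟨⟨h1, h2⟩, ⟨h3, h4⟩⟩
    exact ⟨⟨h1, h3⟩, hflag.isSimplex_union hC h4 h2⟩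

variable [FiniteDimensional ℝ E]

theorem exists_σ_eq : ∃ a b, a ≠ b ∧ T.σ = {a, b} := by
  have h1 : dim T.G.1 + T.σ.card = n := dim_add_card T.e T.G
  have h2 := T.codim_G
  exact Finset.card_eq_two.mp (by omega)

theorem σ_nonempty : T.σ.Nonempty := by
  obtain ⟨a, b, -, h⟩ := T.exists_σ_eq
  rw [h]
  exact Finset.insert_nonempty _ _

/-- The codimension of `G ∩ Q` in `Q` is the number of vertices of the edge `σ` that are not in the
simplex of `Q`. -/
theorem dim_add_two_eq_iff {Q R : Face P.carrier} (h : IsGLB {Q, T.G} R) :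
    dim R.1 + 2 = dim Q.1 ↔ Disjoint (simplexOf T.e Q) T.σ := by
  have h1 := dim_add_card T.e R
  have h2 := dim_add_card T.e Q
  have h3 : T.σ.card = 2 := by
    obtain ⟨a, b, hab, hσ⟩ := T.exists_σ_eq
    rw [hσ, Finset.card_pair hab]
  rw [T.isGLB_G_iff.mp h] at h1
  rw [← Finset.card_union_eq_card_add_card, h3]
  omega

theorem step_of_cuts (Δ : Face P.carrier → PreAbstractSimplicialComplex ℕ) (v : ℕ)
    {Q' : Face P'.carrier} (h : T.Cuts Q') : ∃ R : Face P.carrier, IsGLB {T.oldFace Q', T.G} R ∧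
      T.step Δ v Q' = Δ (T.oldFace Q') ⊔ cone (Δ R) v := by
  have hne : (T.G.1 ∩ (T.oldFace Q').1).Nonempty := by
    rw [Set.inter_comm, Face.inter_nonempty_iff, ← isSimplex_union_iff T.e]
    exact h.2
  have hR := T.isGLB_inter_oldFace Q' hne
  have hdim : dim (T.G.1 ∩ (T.oldFace Q').1) + 2 = dim (T.oldFace Q').1 :=
    (T.dim_add_two_eq_iff hR).mpr h.1
  refine ⟨_, hR, ?_⟩
  unfold step
  rw [dif_pos hne, if_pos hdim]

theorem step_of_not_cuts (Δ : Face P.carrier → PreAbstractSimplicialComplex ℕ) (v : ℕ)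
    {Q' : Face P'.carrier} (h : ¬ T.Cuts Q') : T.step Δ v Q' = Δ (T.oldFace Q') := by
  unfold step
  by_cases hne : (T.G.1 ∩ (T.oldFace Q').1).Nonempty
  · have hR := T.isGLB_inter_oldFace Q' hne
    have hs := T.isGLB_G_iff.mp hR
    have hdim : ¬ dim (T.G.1 ∩ (T.oldFace Q').1) + 2 = dim (T.oldFace Q').1 := fun hd => by
      refine h ⟨(T.dim_add_two_eq_iff hR).mp hd, ?_⟩
      rw [← hs]
      exact isSimplex_simplexOf T.e _
    rw [dif_pos hne, if_neg hdim]
  · rw [dif_neg hne]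

theorem isHelly (T : Truncation P P') (h : IsHelly (Face P.carrier)) :
    IsHelly (Face P'.carrier) := by
  obtain ⟨a, b, -, hσ⟩ := T.exists_σ_eq
  have hmem : ({a, b} : Finset ℕ) ∈ T.K.faces := hσ ▸ T.isSimplex_σ.mem_faces T.σ_nonempty
  rw [isHelly_face_iff T.e] at h
  rw [isHelly_face_iff T.e']
  change IsFlag (stellar T.K T.σ T.w)
  rw [hσ]
  exact h.stellar hmem T.w_new

theorem isSimplex_simplexOf_cases (Q' : Face P'.carrier) :
    (T.w ∉ simplexOf T.e' Q' ∧ IsSimplex T.K (simplexOf T.e' Q') ∧ ¬ T.σ ⊆ simplexOf T.e' Q') ∨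
      (T.w ∈ simplexOf T.e' Q' ∧ ¬ T.σ ⊆ (simplexOf T.e' Q').erase T.w ∧
        IsSimplex T.K ((simplexOf T.e' Q').erase T.w ∪ T.σ)) := by
  have h : IsSimplex (stellar T.K T.σ T.w) (simplexOf T.e' Q') := isSimplex_simplexOf T.e' Q'
  rcases (isSimplex_stellar_iff T.σ_nonempty).mp h with h | h
  · exact Or.inl ⟨h.1.notMem T.w_new, h⟩
  · exact Or.inr h

/-- The alternatives for the polynomial `H` of a face of the truncated polytope. -/
theorem HPolynomial_cases (Q' : Face P'.carrier) :
    (¬ T.Cuts Q' ∧ dim Q'.1 = dim (T.oldFace Q').1 ∧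
      HPolynomial Q'.1 = HPolynomial (T.oldFace Q').1) ∨
    (¬ T.Cuts Q' ∧ dim Q'.1 = dim (T.oldFace Q').1 + 1 ∧
      HPolynomial Q'.1 =
        (MvPolynomial.X 0 + MvPolynomial.X 1) * HPolynomial (T.oldFace Q').1) ∨
    (T.Cuts Q' ∧ dim Q'.1 = dim (T.oldFace Q').1 ∧ ∀ R, IsGLB {T.oldFace Q', T.G} R →
      dim (T.oldFace Q').1 = dim R.1 + 2 ∧ HPolynomial Q'.1 = HPolynomial (T.oldFace Q').1 +
        MvPolynomial.X 0 * MvPolynomial.X 1 * HPolynomial R.1) := by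
  obtain ⟨L, hL, hLn, hH⟩ := exists_finset_isSimplex T.e
  obtain ⟨L', hL', -, hH'⟩ := exists_finset_isSimplex T.e'
  change ∀ s, s ∈ L' ↔ IsSimplex (stellar T.K T.σ T.w) s at hL'
  have hw := T.w_new
  have hd := dim_add_card T.e (T.oldFace Q')
  have hd' := dim_add_card T.e' Q'
  rw [hH', hH]
  rcases T.isSimplex_simplexOf_cases Q' with ⟨hws, hs, hσs⟩ | ⟨hws, hσs, hs⟩
  · have hold : simplexOf T.e (T.oldFace Q') = simplexOf T.e' Q' := by
      rw [simplexOf_oldFace, if_neg hws]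
    -- With exactly one end of the edge in its simplex, `Q` meets `G` in a facet of `Q` or not at
    -- all, and the truncation does not change it combinatorially.
    have one : ∀ a b, a ≠ b → T.σ = {a, b} → a ∈ simplexOf T.e' Q' → b ∉ simplexOf T.e' Q' →
        ¬ T.Cuts Q' ∧ dim Q'.1 = dim (T.oldFace Q').1 ∧
          starSum L' n (MvPolynomial.X 0 - MvPolynomial.X 1) (MvPolynomial.X 1)
            (simplexOf T.e' Q') =
          starSum L n (MvPolynomial.X 0 - MvPolynomial.X 1 : MvPolynomial (Fin 2) ℤ)
            (MvPolynomial.X 1) (simplexOf T.e (T.oldFace Q')) := by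
      intro a b hab hσ ha hb
      rw [hold] at hd ⊢
      rw [hσ] at hL'
      refine ⟨fun hc => ?_, by omega, starSum_stellar_of_mem hab hw hL hL' _ _ _ hws ha hb⟩
      rw [Cuts, hold, hσ, Finset.disjoint_left] at hc
      exact hc.1 ha (by simp)
    obtain ⟨a, b, hab, hσ⟩ := T.exists_σ_eq
    by_cases ha : a ∈ simplexOf T.e' Q'
    · have hb : b ∉ simplexOf T.e' Q' := fun hb => hσs (by
        rw [hσ]
        exact Finset.insert_subset ha (Finset.singleton_subset_iff.mpr hb))
      exact Or.inl (one a b hab hσ ha hb)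
    by_cases hb : b ∈ simplexOf T.e' Q'
    · exact Or.inl (one b a hab.symm (hσ.trans (Finset.pair_comm a b)) hb ha)
    have hdisj : Disjoint (simplexOf T.e (T.oldFace Q')) T.σ := by
      rw [hold, hσ]
      simp [ha, hb]
    have hsum := starSum_stellar_of_disjoint hab hw hL (hσ ▸ hL') hLn
      (MvPolynomial.X 0 - MvPolynomial.X 1 : MvPolynomial (Fin 2) ℤ) (MvPolynomial.X 1) hws ha hb
    rw [sub_add_cancel, ← hσ, ← hold] at hsum
    rw [← hold] at hd' ⊢
    by_cases hc : T.Cuts Q'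
    · refine Or.inr (Or.inr ⟨hc, by omega, fun R hR => ?_⟩)
      have hR' : simplexOf T.e R = simplexOf T.e (T.oldFace Q') ∪ T.σ :=
        (isGLB_iff_simplexOf T.e).mp hR
      have h1 := dim_add_card T.e R
      rw [hR', Finset.card_union_of_disjoint hdisj, hσ, Finset.card_pair hab] at h1
      refine ⟨by omega, ?_⟩
      rw [hsum, hH, hR']
    · refine Or.inl ⟨hc, by omega, ?_⟩
      -- Here `G` does not meet `Q`: no simplex contains both `σ` and the simplex of `Q`, so the
      -- correction term is an empty sum.
      have hz : starSum L n (MvPolynomial.X 0 - MvPolynomial.X 1 : MvPolynomial (Fin 2) ℤ)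
          (MvPolynomial.X 1) (simplexOf T.e (T.oldFace Q') ∪ T.σ) = 0 := by
        rw [starSum, Finset.filter_false_of_mem, Finset.sum_empty]
        exact fun u hu hsub => hc ⟨hdisj, ((hL u).mp hu).mono hsub⟩
      rw [hsum, hz, mul_zero, add_zero]
  · have hold : simplexOf T.e (T.oldFace Q') = (simplexOf T.e' Q').erase T.w ∪ T.σ := by
      rw [simplexOf_oldFace, if_pos hws]
    have hc : ¬ T.Cuts Q' := by
      intro hc
      obtain ⟨x, hx⟩ := T.σ_nonempty
      rw [Cuts, hold, Finset.disjoint_left] at hc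
      exact hc.1 (Finset.mem_union_right _ hx) hx
    obtain ⟨τ, hwτ, hτ⟩ : ∃ τ, T.w ∉ τ ∧ simplexOf T.e' Q' = insert T.w τ :=
      ⟨_, Finset.notMem_erase _ _, (Finset.insert_erase hws).symm⟩
    rw [hτ, Finset.card_insert_of_notMem hwτ] at hd'
    rw [hτ, Finset.erase_insert hwτ] at hold hσs
    rw [hτ]
    -- Here `Q'` is the copy of `Q` in one of the two ends of the section facet `G × I`.
    have one : ∀ a b, a ≠ b → T.σ = {a, b} → a ∈ τ → b ∉ τ →
        ¬ T.Cuts Q' ∧ dim Q'.1 = dim (T.oldFace Q').1 ∧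
          starSum L' n (MvPolynomial.X 0 - MvPolynomial.X 1) (MvPolynomial.X 1) (insert T.w τ) =
          starSum L n (MvPolynomial.X 0 - MvPolynomial.X 1 : MvPolynomial (Fin 2) ℤ)
            (MvPolynomial.X 1) (simplexOf T.e (T.oldFace Q')) := by
      intro a b hab hσ ha hb
      rw [hσ] at hL' hold
      have hcard : (τ ∪ {a, b}).card = τ.card + 1 := by
        rw [Finset.union_insert, Finset.union_singleton, Finset.insert_comm,
          Finset.insert_eq_of_mem ha, Finset.card_insert_of_notMem hb]
      rw [hold, hcard] at hd
      refine ⟨hc, by omega, ?_⟩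
      rw [hold]
      exact starSum_stellar_insert_of_mem hab hw hL hL' _ _ _ hwτ ha hb
    obtain ⟨a, b, hab, hσ⟩ := T.exists_σ_eq
    by_cases ha : a ∈ τ
    · have hb : b ∉ τ := fun hb => hσs (by
        rw [hσ]
        exact Finset.insert_subset ha (Finset.singleton_subset_iff.mpr hb))
      exact Or.inl (one a b hab hσ ha hb)
    by_cases hb : b ∈ τ
    · exact Or.inl (one b a hab.symm (hσ.trans (Finset.pair_comm a b)) hb ha)
    -- With neither end of the edge in `τ`, the face `Q'` is the prism `Q × I`.
    have hsum := starSum_stellar_insert_of_disjoint hab hw hL (hσ ▸ hL') hLn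
      (MvPolynomial.X 0 - MvPolynomial.X 1 : MvPolynomial (Fin 2) ℤ) (MvPolynomial.X 1) hwτ ha hb
    rw [hσ] at hold
    rw [hold, Finset.card_union_of_disjoint (by simp [ha, hb]), Finset.card_pair hab] at hd
    refine Or.inr (Or.inl ⟨hc, by omega, ?_⟩)
    rw [hsum, hold]
    congr 1
    ring

end Truncation

/-! ### The complexes `Δ(Q)` -/

/-- The properties of the complexes `Δ(Q)` that are preserved by truncations. All of them are
complexes of cliques of one graph `Γ`, on vertex sets that are compatible with intersections. -/
structure IsGammaFamily {n : ℕ} (P : ConvexPolytope E n) (m : ℕ)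
    (Δ : Face P.carrier → PreAbstractSimplicialComplex ℕ) : Prop where
  isHelly : IsHelly (Face P.carrier)
  exists_graph : ∃ (Γ : ℕ → ℕ → Prop) (W : Face P.carrier → Set ℕ),
    (∀ Q, IsCliqueComplex (Δ Q) Γ (W Q)) ∧ (∀ Q, ∀ v ∈ W Q, v < m) ∧
      ∀ A B C, IsGLB {A, B} C → W C = W A ∩ W B
  isGamma : ∀ Q : Face P.carrier, IsGammaPolynomial Q.1 (fPolynomial (Δ Q))

namespace IsGammaFamily

variable {n m : ℕ} {P P' : ConvexPolytope E n}
  {Δ : Face P.carrier → PreAbstractSimplicialComplex ℕ}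

theorem subset_range (h : IsGammaFamily P m Δ) (Q : Face P.carrier) :
    ∀ s ∈ (Δ Q).faces, s ⊆ Finset.range m := by
  obtain ⟨Γ, W, h1, h2, -⟩ := h.exists_graph
  intro s hs v hv
  exact Finset.mem_range.mpr (h2 Q v (((h1 Q s).mp hs).2.1 v hv))

theorem finite_faces (h : IsGammaFamily P m Δ) (Q : Face P.carrier) : (Δ Q).faces.Finite :=
  (Finset.range m).powerset.finite_toSet.subset fun s hs =>
    Finset.mem_coe.mpr (Finset.mem_powerset.mpr (h.subset_range Q s hs))

theorem isFlag (h : IsGammaFamily P m Δ) (Q : Face P.carrier) : IsFlag (Δ Q) := by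
  obtain ⟨Γ, W, h1, -⟩ := h.exists_graph
  exact (h1 Q).isFlag

theorem cube [FiniteDimensional ℝ E] (e : Face P.carrier ≃o Face (unitCube n)) :
    IsGammaFamily P 0 fun _ => ⊥ := by
  refine ⟨isHelly_unitCube.of_orderIso e, ⟨fun _ _ => False, fun _ => ∅, fun Q s => ?_, ?_, ?_⟩,
    fun Q => ?_⟩
  · refine ⟨False.elim, fun h => ?_⟩
    obtain ⟨v, hv⟩ := h.1
    exact h.2.1 v hv
  · exact fun _ _ h => h.elim
  · simp
  · rw [fPolynomial_bot]
    exact isGammaPolynomial_of_cube e Q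

theorem step [FiniteDimensional ℝ E] (h : IsGammaFamily P m Δ) (T : Truncation P P') :
    IsGammaFamily P' (m + 1) (T.step Δ m) := by
  classical
  have hsub := h.subset_range
  have hfin := h.finite_faces
  obtain ⟨hHelly, ⟨Γ, W, hclique, hWm, hglb⟩, hgamma⟩ := h
  have hm : ∀ Q, m ∉ W Q := fun Q hmem => (hWm Q m hmem).false
  -- The new vertex gets the same neighbours `W T.G` whatever the face: inside `Δ(Q)` they span
  -- `W(Q) ∩ W(G) = W(G ∩ Q)`, the vertex set of the base of the cone.
  refine ⟨T.isHelly hHelly, ⟨extendGraph Γ m (W T.G),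
    fun Q' => if T.Cuts Q' then insert m (W (T.oldFace Q')) else W (T.oldFace Q'),
    fun Q' => ?_, fun Q' v hv => ?_, fun A B C hC => ?_⟩, fun Q' => ?_⟩
  · by_cases hc : T.Cuts Q'
    · obtain ⟨R, hR, hstep⟩ := T.step_of_cuts Δ m hc
      simp only [hstep, if_pos hc]
      exact (hclique _).sup_cone (hglb _ _ _ hR ▸ hclique R) (hm _)
    · simp only [T.step_of_not_cuts Δ m hc, if_neg hc]
      exact (hclique _).extendGraph (hm _) _
  · dsimp only at hv
    split_ifs at hv with hc
    · rcases hv with rfl | hv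
      · exact Nat.lt_succ_self _
      · exact (hWm _ v hv).trans (Nat.lt_succ_self m)
    · exact (hWm _ v hv).trans (Nat.lt_succ_self m)
  · have h1 := T.cuts_iff_of_isGLB hHelly hC
    have h2 := hglb _ _ _ (T.isGLB_oldFace hC)
    have hA := hm (T.oldFace A)
    have hB := hm (T.oldFace B)
    -- If only one of the two faces is cut, `m` must not be in the intersection; this holds because
    -- `m` is in no old vertex set.
    by_cases hcA : T.Cuts A <;> by_cases hcB : T.Cuts B <;>
      simp only [h1, hcA, hcB, and_self, and_true, and_false, if_true, if_false, h2]
    · rw [Set.insert_inter_distrib]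
    · rw [Set.insert_inter_of_notMem hB]
    · rw [Set.inter_insert_of_notMem hA]
  · rcases T.HPolynomial_cases Q' with ⟨hc, hd, hH⟩ | ⟨hc, hd, hH⟩ | ⟨hc, hd, hR⟩
    · rw [T.step_of_not_cuts Δ m hc]
      exact (hgamma _).congr hd hH
    · rw [T.step_of_not_cuts Δ m hc]
      exact (hgamma _).prism hd hH
    · obtain ⟨R, hGLB, hstep⟩ := T.step_of_cuts Δ m hc
      obtain ⟨hdR, hH⟩ := hR R hGLB
      have hLK : (Δ R).faces ⊆ (Δ (T.oldFace Q')).faces := by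
        intro s hs
        obtain ⟨h1, h2, h3⟩ := (hclique R s).mp hs
        rw [hglb _ _ _ hGLB] at h2
        exact (hclique _ s).mpr ⟨h1, fun v hv => (h2 v hv).1, h3⟩
      rw [hstep, fPolynomial_sup_cone hLK (hfin _) fun s hs hms =>
        (Finset.mem_range.mp (hsub _ s hs hms)).false]
      exact (hgamma _).truncate (hgamma R) hd hdR hH

end IsGammaFamily

theorem TruncationSequence.isGammaFamily [FiniteDimensional ℝ E] {n m : ℕ}
    {P : ConvexPolytope E n} (S : TruncationSequence P m) : IsGammaFamily P m S.Δ := by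
  induction S with
  | cube P e => exact IsGammaFamily.cube e
  | truncate S P' T ih => exact ih.step T

end TwoTruncatedCube

end

theorem mainTheorem1 {E : Type*} [NormedAddCommGroup E] [NormedSpace ℝ E]
    [FiniteDimensional ℝ E] {n : ℕ} (P : TwoTruncatedCube.ConvexPolytope E n)
    (hP : TwoTruncatedCube.IsTwoTruncatedCube P) :
    (∃ Δ : PreAbstractSimplicialComplex ℕ, Δ.faces.Finite ∧ TwoTruncatedCube.IsFlag Δ ∧
      TwoTruncatedCube.IsGammaPolynomial P.carrier (TwoTruncatedCube.fPolynomial Δ)) ∧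
    ∀ (m : ℕ) (S : TwoTruncatedCube.TruncationSequence P m)
      (Q : TwoTruncatedCube.Face P.carrier),
      (∀ s ∈ (S.Δ Q).faces, s ⊆ Finset.range m) ∧
      TwoTruncatedCube.IsFlag (S.Δ Q) ∧
      TwoTruncatedCube.IsGammaPolynomial Q.1 (TwoTruncatedCube.fPolynomial (S.Δ Q)) := by
  refine ⟨?_, fun m S Q => ⟨S.isGammaFamily.subset_range Q, S.isGammaFamily.isFlag Q,
    S.isGammaFamily.isGamma Q⟩⟩
  obtain ⟨m, ⟨S⟩⟩ := hP
  exact ⟨S.Δ P.topFace, S.isGammaFamily.finite_faces _, S.isGammaFamily.isFlag _,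
    S.isGammaFamily.isGamma P.topFace⟩
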